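/- **Corollary 13 (convex bodies).** Let $d\ge 1$ and let $F,K\subset\mathbb R^d$ be convex bodies (nonempty compact convex sets) such that $F$ has interior points. Then the set-valued mapping $F(\varepsilon)=F+\varepsilon K$, $0\le\varepsilon\le1$, is differentiable at $F$ for $\varepsilon=0$, and $$\frac{d}{d\varepsilon}F(\varepsilon)\Big|_{\varepsilon=0}=(h_{K,F})_{\rm sub}:=\{(t,x,u)\in\Sigma: 0<t\le h_K(u)\}\cup\{(t,x,u)\in\Sigma: h_K(u)\le t<0\},$$ where $h_K(u)=\max_{y\in K}\langle y,u\rangle$ is the support function of $K$. Here the following notions are used. For a closed set $G$ let $d_G(z)$ be the distance of $z$ from $G$, $p_G(z)$ a point of $G$ nearest to $z$, $S_G$ the set of points for which this nearest point is not unique, and $u_G(z)=(z-p_G(z))/d_G(z)$ for $z\notin S_G\cup G$. For $x\in\partial G$ let $N_G(x)=\{u_G(z): z\notin S_G\cup G,\ p_G(z)=x\}$, let $\mathrm{Nor}(G)=\{(x,u):x\in\partial G,\ u\in N_G(x)\}$, and let $\mathrm{reg}(G)$ be the set of all $x\in\partial G$ for which $N_G(x)$ is of the form $\{u\}$ or $\{u,-u\}$.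 Let $F^*$ be the closure of the complement of $F$, and put $\mathrm{Nor}_e(F)=\mathrm{Nor}(F)\cup\{(x,-u):(x,u)\in\mathrm{Nor}(F^*)\}$, $\Sigma=\mathbb R\times\mathrm{Nor}_e(F)$ and $\mathrm{reg}_e(F)=\mathrm{reg}(F)\cup\mathrm{reg}(F^*)$. The support measure $\Theta_{d-1}(F,\cdot)$ is the image of the $(d-1)$-dimensional Hausdorff measure on $\mathrm{reg}_e(F)$ under $x\mapsto(x,\nu(F,x))$, where $\nu(F,x)$ is the vector $u$ with $(x,u)\in\mathrm{Nor}_e(F)$; and $M=\mu_1\otimes\Theta_{d-1}(F,\cdot)$, where $\mu_k$ denotes Lebesgue measure in $\mathbb R^k$. For $\varepsilon>0$ the local magnification map is $$\tau_\varepsilon(z)=\begin{cases}\big(d_F(z)/\varepsilon,\ p_F(z),\ u_F(z)\big), & z\notin S_F\cup F,\\ \big(-d_{F^*}(z)/\varepsilon,\ p_{F^*}(z),\ -u_{F^*}(z)\big), & z\notin S_{F^*}\cup F^*,\end{cases}$$ and $\tau_\varepsilon(A)=\{\tau_\varepsilon(z): z\in A\setminus(S_{\partial F}\cup\partial F)\}$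 for $A\subset\mathbb R^d$. A family $F(\varepsilon)$, $0\le\varepsilon\le 1$, with $F(0)=F$ is *differentiable at $F$ for $\varepsilon=0$, with derivative* a Borel set $B\subset\Sigma$, if the sets $A(\varepsilon)=F(\varepsilon)\triangle F$ are Borel sets with $A(0)\subset\partial F$, there is some $T>0$ with $$\frac1\varepsilon\,\mu_d\big(\{z\in A(\varepsilon): d_{\partial F}(z)>\varepsilon T\}\big)\to0\quad\text{as }\varepsilon\to0,$$ and $M(\tau_\varepsilon(A(\varepsilon))\triangle B)\to0$ as $\varepsilon\to0$. (The derivative is determined only up to $M$-null sets.) -/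

import Mathlib

open MeasureTheory Filter Topology Set
open scoped Pointwise ENNReal symmDiff

noncomputable section

namespace SetDerivative

/-- The Euclidean space `ℝᵈ`. -/
abbrev E (d : ℕ) : Type := EuclideanSpace ℝ (Fin d)

variable {d : ℕ}

/-- `x` is a point of `F` nearest to `z`. -/
def IsNearest (F : Set (E d)) (z x : E d) : Prop :=
  x ∈ F ∧ dist z x = Metric.infDist z F

/-- The metric projection `p_F(z)`. It is a point of `F` nearest to `z` whenever there is one
(always, if `F` is nonempty and closed), and the only one if `z ∉ skeleton F`. -/
def proj (F : Set (E d)) (z : E d) : E d :=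
  Classical.epsilon (IsNearest F z)

/-- The skeleton `S_F`: the points whose metric projection onto `F` is not unique. -/
def skeleton (F : Set (E d)) : Set (E d) :=
  {z | ∃ x y, IsNearest F z x ∧ IsNearest F z y ∧ x ≠ y}

/-- The direction `u_F(z) = (z - p_F(z)) / d_F(z)`. -/
def dir (F : Set (E d)) (z : E d) : E d :=
  (Metric.infDist z F)⁻¹ • (z - proj F z)

/-- `N(x)`: the set of all (outer) normals of `F` in `x`. -/
def normals (F : Set (E d)) (x : E d) : Set (E d) :=
  {u | ∃ z, z ∉ skeleton F ∪ F ∧ proj F z = x ∧ dir F z = u}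

/-- The (generalized) normal bundle `Nor(F)`. -/
def Nor (F : Set (E d)) : Set (E d × E d) :=
  {q | q.1 ∈ frontier F ∧ q.2 ∈ normals F q.1}

/-- `F*`, the closure of the complement of `F`. -/
def coClosure (F : Set (E d)) : Set (E d) := closure Fᶜ

/-- The extended normal bundle `Nor_e(F) = Nor(F) ∪ R(Nor(F*))` with `R(x,u) = (x,-u)`. -/
def NorE (F : Set (E d)) : Set (E d × E d) :=
  Nor F ∪ (fun q : E d × E d => (q.1, -q.2)) '' Nor (coClosure F)

/-- The regular boundary points of `F`: those with exactly one normal `u`, or with exactly two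
antipodal normals `u, -u`. -/
def reg (F : Set (E d)) : Set (E d) :=
  {x | x ∈ frontier F ∧ ∃ u, normals F x = {u} ∨ normals F x = {u, -u}}

/-- `reg_e(F) = reg(F) ∪ reg(F*)`. -/
def regE (F : Set (E d)) : Set (E d) := reg F ∪ reg (coClosure F)

/-- `ν(F,x)`: the vector `u` with `(x,u) ∈ Nor_e(F)`. -/
def nu (F : Set (E d)) (x : E d) : E d :=
  Classical.epsilon fun u => (x, u) ∈ NorE F

/-- The support measure `Θ_{d-1}(F,·) = ∫_{reg_e(F)} 1{(x,ν(F,x)) ∈ ·} H^{d-1}(dx)` of a solid set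
`F`, as a measure on `ℝᵈ × ℝᵈ` concentrated on `Nor_e(F)`. Here `H^{d-1}` is the Hausdorff measure
in the normalization that gives a unit cube of dimension `d-1` the measure `1`. -/
def Theta (F : Set (E d)) : Measure (E d × E d) :=
  ((Measure.euclideanHausdorffMeasure (d - 1) : Measure (E d)).restrict (regE F)).map
    fun x => (x, nu F x)

/-- The normal cylinder `Σ(F) = ℝ × Nor_e(F)`. -/
def cylinder (F : Set (E d)) : Set (ℝ × E d × E d) := univ ×ˢ NorE F

/-- The measure `M_F = μ₁ ⊗ Θ_{d-1}(F,·)` on the normal cylinder. -/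
def M (F : Set (E d)) : Measure (ℝ × E d × E d) :=
  (volume : Measure ℝ).prod (Theta F)

open Classical in
/-- The local magnification map `τ_ε`. It is used only at points `z ∉ S_{∂F} ∪ ∂F`, where
`z ∉ F` means that `z` lies outside `F`, and `z ∈ F` that `z` lies outside `F*`. -/
def tau (F : Set (E d)) (ε : ℝ) (z : E d) : ℝ × E d × E d :=
  if z ∉ F then (Metric.infDist z F / ε, proj F z, dir F z)
  else (-(Metric.infDist z (coClosure F) / ε), proj (coClosure F) z, -dir (coClosure F) z)

/-- `τ_ε(A) = {τ_ε(z) : z ∈ A \ (S_{∂F} ∪ ∂F)}`. -/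
def tauImage (F : Set (E d)) (ε : ℝ) (A : Set (E d)) : Set (ℝ × E d × E d) :=
  tau F ε '' (A \ (skeleton (frontier F) ∪ frontier F))

/-- The family `A(ε)` is essentially bounded: for some `T > 0`,
`ε⁻¹ μ_d(A(ε) \ (∂F)_{εT}) → 0` as `ε → 0`, where `(∂F)_{εT} = {z : d(z, ∂F) ≤ εT}`. -/
def EssentiallyBounded (F : Set (E d)) (A : ℝ → Set (E d)) : Prop :=
  ∃ T : ℝ, 0 < T ∧
    Tendsto (fun ε : ℝ => ENNReal.ofReal ε⁻¹ *
      volume (A ε ∩ (Metric.cthickening (ε * T) (frontier F))ᶜ)) (𝓝[>] 0) (𝓝 0)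

/-- The family `A(ε)`, `0 ≤ ε ≤ 1`, of Borel sets with `A(0) ⊆ ∂F` is differentiable at `∂F` for
`ε = 0`, with derivative the Borel set `B ⊆ Σ(F)`. -/
structure HasBoundaryDeriv (F : Set (E d)) (A : ℝ → Set (E d)) (B : Set (ℝ × E d × E d)) :
    Prop where
  measurable : ∀ ε ∈ Icc (0 : ℝ) 1, MeasurableSet (A ε)
  zero_subset : A 0 ⊆ frontier F
  bounded : EssentiallyBounded F A
  measurable_deriv : MeasurableSet B
  deriv_subset : B ⊆ cylinder F
  tendsto : Tendsto (fun ε : ℝ => M F (tauImage F ε (A ε) ∆ B)) (𝓝[>] 0) (𝓝 0)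

/-- The family `G(ε)`, `0 ≤ ε ≤ 1`, with `G(0) = F` has derivative `B` at `F` for `ε = 0`. -/
def HasSetDeriv (F : Set (E d)) (G : ℝ → Set (E d)) (B : Set (ℝ × E d × E d)) : Prop :=
  G 0 = F ∧ HasBoundaryDeriv F (fun ε => G ε ∆ F) B

/-- The family `G(ε)`, `0 ≤ ε ≤ 1`, is differentiable at `F` for `ε = 0`. -/
def SetDifferentiable (F : Set (E d)) (G : ℝ → Set (E d)) : Prop :=
  ∃ B, HasSetDeriv F G B

/-- The support function `h_K(u) = max {⟨y, u⟩ : y ∈ K}`. -/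
def supportFun (K : Set (E d)) (u : E d) : ℝ :=
  sSup ((fun y => inner ℝ y u) '' K)

/-- The set `(h_{K,F})_sub`. -/
def hSub (K F : Set (E d)) : Set (ℝ × E d × E d) :=
  {q | q ∈ cylinder F ∧ 0 < q.1 ∧ q.1 ≤ supportFun K q.2.2} ∪
  {q | q ∈ cylinder F ∧ supportFun K q.2.2 ≤ q.1 ∧ q.1 < 0}

end SetDerivative

end

namespace SetDerivative

variable {d : ℕ} {F : Set (E d)} {x u z : E d}

/-! ### Nearest points -/

/-! In coordinates z = x + εtu, with u a unit outer normal at x, the question is when z lies in F +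
εK. The supporting half-space at x gives t ≤ h_K(u) whenever it does (`IsNormal.le_supportFun`).
Conversely, let t < h_K(u) and let k ∈ K attain h_K(u). Then v = tu − k points strictly inward. If F
contains a ball touching its boundary at x, then x + εv ∈ F for small ε, so z ∈ F + εK
(`IsNormal.eventually_mem_iff`).

Such a ball exists at almost every boundary point (`euclideanHausdorffMeasure_not_hasInnerBall`). In
a chart, the boundary is the graph of a Lipschitz function, with base points x' and slopes p. By
monotonicity, x' is a 1-Lipschitz function of y = x' + p. Rademacher's theorem and Sard's lemma show
that almost every x' is the image of a parameter y at which this function has an invertible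
derivative. There the slope changes at most linearly and the boundary bends at most quadratically,
which leaves room for a ball.

By `NorE_eq` and `regE_eq` the extended normal bundle and the regular points are the classical ones.
The difference between the magnified set and `hSub` lies in a measurable `errorSet` with bounded t.
Almost every point eventually leaves `errorSet`, and Θ is finite, so dominated convergence finishes
the proof. -/

theorem isNearest_proj (hF : IsClosed F) (hne : F.Nonempty) (z : E d) :
    IsNearest F z (proj F z) := by
  obtain ⟨y, hy, h⟩ := hF.exists_infDist_eq_dist hne z
  exact Classical.epsilon_spec (p := IsNearest F z) ⟨y, hy, h.symm⟩

/-- If the squared distance from `z` grows at least quadratically on `G` away from `x ∈ G`, then `x`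
is the only point of `G` nearest to `z`. -/
theorem unique_nearest_of_quadratic_growth {t c : ℝ} (hc : 0 < c) (hx : x ∈ F)
    (hzx : dist z x = t) (h : ∀ y ∈ F, t ^ 2 + c * ‖y - x‖ ^ 2 ≤ dist z y ^ 2) :
    Metric.infDist z F = t ∧ proj F z = x ∧ z ∉ skeleton F := by
  have ht : 0 ≤ t := hzx ▸ dist_nonneg
  have hd : Metric.infDist z F = t := by
    refine le_antisymm (hzx ▸ Metric.infDist_le_dist_of_mem hx) ?_
    refine (Metric.le_infDist ⟨x, hx⟩).2 fun y hy => ?_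
    refine abs_le_of_sq_le_sq' ?_ dist_nonneg |>.2
    nlinarith [h y hy, mul_nonneg hc.le (sq_nonneg ‖y - x‖)]
  have hu : ∀ y, IsNearest F z y → y = x := by
    rintro y ⟨hy, hyd⟩
    have h1 := h y hy
    rw [hyd, hd] at h1
    have h2 : ‖y - x‖ ^ 2 ≤ 0 := by
      by_contra hcon
      push Not at hcon
      nlinarith [mul_pos hc hcon]
    have h3 : ‖y - x‖ = 0 := by
      have := sq_nonneg ‖y - x‖
      exact pow_eq_zero_iff (two_ne_zero) |>.1 (le_antisymm h2 this)
    exact sub_eq_zero.1 (norm_eq_zero.1 h3)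
  have hxn : IsNearest F z x := ⟨hx, by rw [hzx, hd]⟩
  refine ⟨hd, hu _ (Classical.epsilon_spec (p := IsNearest F z) ⟨x, hxn⟩), ?_⟩
  rintro ⟨a, b, ha, hb, hab⟩
  exact hab ((hu a ha).trans (hu b hb).symm)

theorem infDist_pos_of_notMem (hF : IsClosed F) (hne : F.Nonempty) (hz : z ∉ F) :
    0 < Metric.infDist z F :=
  (hF.notMem_iff_infDist_pos hne).1 hz

theorem proj_add_smul_dir (h : 0 < Metric.infDist z F) :
    proj F z + Metric.infDist z F • dir F z = z := by
  rw [dir, smul_smul, mul_inv_cancel₀ h.ne', one_smul, add_sub_cancel]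

theorem norm_dir (hF : IsClosed F) (hne : F.Nonempty) (hz : z ∉ F) : ‖dir F z‖ = 1 := by
  have h := infDist_pos_of_notMem hF hne hz
  have h2 := (isNearest_proj hF hne z).2
  rw [dist_eq_norm] at h2
  rw [dir, norm_smul, h2, Real.norm_of_nonneg (inv_nonneg.2 h.le), inv_mul_cancel₀ h.ne']

/-! ### Normals of convex sets -/

/-- `u` is a unit outer normal vector of `F` at the point `x ∈ F`, in the sense of convex
geometry. -/
def IsNormal (F : Set (E d)) (x u : E d) : Prop :=
  x ∈ F ∧ ‖u‖ = 1 ∧ ∀ y ∈ F, inner ℝ (y - x) u ≤ 0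

theorem norm_add_smul_sq {w u : E d} (hu : ‖u‖ = 1) (s : ℝ) :
    ‖w + s • u‖ ^ 2 = ‖w‖ ^ 2 + 2 * s * inner ℝ w u + s ^ 2 := by
  rw [norm_add_sq_real, inner_smul_right, norm_smul, hu, Real.norm_eq_abs, mul_one, sq_abs]
  ring

/-- The cross term has a favourable sign. The factor 1 plays the role of `c` in
`unique_nearest_of_quadratic_growth`. -/
theorem IsNormal.growth (h : IsNormal F x u) {t : ℝ} (ht : 0 ≤ t) {y : E d} (hy : y ∈ F) :
    t ^ 2 + 1 * ‖y - x‖ ^ 2 ≤ dist (x + t • u) y ^ 2 := by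
  have e : x + t • u - y = (x - y) + t • u := by abel
  rw [dist_eq_norm, e, norm_add_smul_sq h.2.1, norm_sub_rev x y]
  have h1 := h.2.2 y hy
  have h2 : inner ℝ (x - y) u = - inner ℝ (y - x) u := by rw [← neg_sub, inner_neg_left]
  rw [h2]
  nlinarith [mul_nonneg ht (neg_nonneg.2 h1)]

theorem dist_add_smul (hu : ‖u‖ = 1) {t : ℝ} (ht : 0 ≤ t) : dist (x + t • u) x = t := by
  rw [dist_eq_norm, add_sub_cancel_left, norm_smul, hu, Real.norm_of_nonneg ht, mul_one]

theorem IsNormal.notMem (h : IsNormal F x u) {t : ℝ} (ht : 0 < t) : x + t • u ∉ F := by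
  intro hm
  have := h.2.2 _ hm
  rw [add_sub_cancel_left, inner_smul_left, real_inner_self_eq_norm_sq, h.2.1] at this
  simp at this
  linarith

theorem IsNormal.mem_closure_compl (h : IsNormal F x u) : x ∈ coClosure F := by
  refine mem_closure_of_tendsto (f := fun t : ℝ => x + t • u) (b := 𝓝[>] 0) ?_
    (eventually_mem_nhdsWithin.mono fun t ht => h.notMem ht)
  have : Tendsto (fun t : ℝ => x + t • u) (𝓝 0) (𝓝 (x + (0 : ℝ) • u)) :=
    Continuous.tendsto (by fun_prop) 0
  simpa using this.mono_left nhdsWithin_le_nhds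

theorem IsNormal.mem_frontier (h : IsNormal F x u) : x ∈ frontier F := by
  rw [frontier_eq_closure_inter_closure]
  exact ⟨subset_closure h.1, h.mem_closure_compl⟩

theorem IsNormal.outer (h : IsNormal F x u) {t : ℝ} (ht : 0 < t) :
    Metric.infDist (x + t • u) F = t ∧ proj F (x + t • u) = x ∧ dir F (x + t • u) = u ∧
      x + t • u ∉ skeleton F := by
  obtain ⟨h1, h2, h3⟩ := unique_nearest_of_quadratic_growth one_pos h.1
    (dist_add_smul h.2.1 ht.le) fun y hy => h.growth ht.le hy
  refine ⟨h1, h2, ?_, h3⟩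
  rw [dir, h1, h2, add_sub_cancel_left, smul_smul, inv_mul_cancel₀ ht.ne', one_smul]

/-- `tauImage` discards the skeleton of the boundary, not that of F; since the boundary lies in F,
the same growth estimate covers it. -/
theorem IsNormal.outer_notMem_skeleton_frontier (hF : IsClosed F) (h : IsNormal F x u) {t : ℝ}
    (ht : 0 < t) : x + t • u ∉ skeleton (frontier F) :=
  (unique_nearest_of_quadratic_growth one_pos h.mem_frontier
    (dist_add_smul h.2.1 ht.le) fun _ hy => h.growth ht.le (hF.frontier_subset hy)).2.2

/-- Outside of a closed convex set, the metric projection provides normals. -/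
theorem isNormal_proj (hF : IsClosed F) (hconv : Convex ℝ F) (hne : F.Nonempty) (hz : z ∉ F) :
    IsNormal F (proj F z) (dir F z) := by
  have h := infDist_pos_of_notMem hF hne hz
  obtain ⟨hm, hd⟩ := isNearest_proj hF hne z
  refine ⟨hm, norm_dir hF hne hz, fun y hy => ?_⟩
  have key : inner ℝ (z - proj F z) (y - proj F z) ≤ 0 := by
    refine (norm_eq_iInf_iff_real_inner_le_zero hconv hm).1 ?_ y hy
    rw [← dist_eq_norm, hd, Metric.infDist_eq_iInf]
    simp_rw [dist_eq_norm]
  rw [dir, inner_smul_right, real_inner_comm]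
  exact mul_nonpos_of_nonneg_of_nonpos (inv_nonneg.2 h.le) key

/-- If a ball contained in `F` touches the boundary of `F`, then its centre determines the
normal. -/
theorem IsNormal.eq_of_closedBall (h : IsNormal F x u) {r : ℝ} (hr : 0 < r) {v : E d}
    (hv : ‖v‖ = 1) (hb : Metric.closedBall (x - r • v) r ⊆ F) : u = v := by
  -- The point of the ball farthest in direction u forces ⟨v, u⟩ ≥ 1, the equality case of
  -- Cauchy–Schwarz.
  have hm : x - r • v + r • u ∈ F := hb (by
    rw [Metric.mem_closedBall, dist_eq_norm, add_sub_cancel_left, norm_smul, h.2.1,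
      Real.norm_of_nonneg hr.le, mul_one])
  have h1 := h.2.2 _ hm
  have e : x - r • v + r • u - x = r • u - r • v := by abel
  rw [e, inner_sub_left, inner_smul_left, inner_smul_left, real_inner_self_eq_norm_sq, h.2.1] at h1
  simp only [conj_trivial, one_pow, mul_one] at h1
  have h2 : inner ℝ v u ≤ 1 := by
    have := real_inner_le_norm v u
    rwa [hv, h.2.1, mul_one] at this
  have h3 : inner ℝ v u = 1 := le_antisymm h2 (by
    by_contra hcon
    push Not at hcon
    nlinarith)
  exact ((inner_eq_one_iff_of_norm_eq_one hv h.2.1).1 h3).symm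

theorem exists_isNormal_of_mem_frontier (hF : IsClosed F) (hconv : Convex ℝ F)
    (hint : (interior F).Nonempty) (hx : x ∈ frontier F) : ∃ u, IsNormal F x u := by
  have hxF := hF.frontier_subset hx
  obtain ⟨f, s, hf, h1, h2⟩ := geometric_hahn_banach_of_nonempty_interior hconv
    (convex_singleton x) (disjoint_singleton_right.2 hx.2) hint (singleton_nonempty x)
  set v := (InnerProductSpace.toDual ℝ (E d)).symm f with hv
  have hv0 : v ≠ 0 := by simpa [hv] using hf
  have hfv : ∀ y, f y = inner ℝ y v := fun y => by
    rw [real_inner_comm, hv, InnerProductSpace.toDual_symm_apply]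
  refine ⟨‖v‖⁻¹ • v, hxF, ?_, fun y hy => ?_⟩
  · rw [norm_smul, norm_inv, norm_norm, inv_mul_cancel₀ (norm_ne_zero_iff.2 hv0)]
  · rw [inner_smul_right, inner_sub_left, ← hfv, ← hfv]
    have := (h1 y hy).trans (h2 x rfl)
    exact mul_nonpos_of_nonneg_of_nonpos (by positivity) (by linarith)

/-! ### Inner tangent balls -/

/-- `F` contains a nondegenerate closed ball that touches its boundary at `x` with outer
normal `u`. -/
def HasInnerBall (F : Set (E d)) (x u : E d) : Prop :=
  ∃ r : ℝ, 0 < r ∧ Metric.closedBall (x - r • u) r ⊆ F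

theorem mem_closedBall_sub_smul (hu : ‖u‖ = 1) {r : ℝ} (hr : 0 ≤ r) {w : E d} :
    x + w ∈ Metric.closedBall (x - r • u) r ↔ ‖w‖ ^ 2 + 2 * r * inner ℝ w u ≤ 0 := by
  have e : x + w - (x - r • u) = w + r • u := by abel
  rw [Metric.mem_closedBall, dist_eq_norm, e, ← sq_le_sq₀ (norm_nonneg _) hr,
    norm_add_smul_sq hu]
  constructor <;> intro h <;> linarith

theorem closedBall_sub_smul_mono (hu : ‖u‖ = 1) {r s : ℝ} (hr : 0 ≤ r) (hrs : r ≤ s) :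
    Metric.closedBall (x - r • u) r ⊆ Metric.closedBall (x - s • u) s := by
  intro y hy
  have e : y = x + (y - x) := by abel
  rw [e] at hy ⊢
  rw [mem_closedBall_sub_smul hu hr] at hy
  rw [mem_closedBall_sub_smul hu (hr.trans hrs)]
  rcases hr.eq_or_lt with rfl | hr
  · have h0 : ‖y - x‖ = 0 := by
      have := norm_nonneg (y - x)
      nlinarith
    rw [norm_eq_zero.1 h0]; simp
  · have hn : inner ℝ (y - x) u ≤ 0 := by
      by_contra hcon
      push Not at hcon
      nlinarith [mul_pos hr hcon, sq_nonneg ‖y - x‖]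
    nlinarith [mul_nonneg (sub_nonneg.2 hrs) (neg_nonneg.2 hn)]

theorem sub_smul_mem_interior (hu : ‖u‖ = 1) {s t : ℝ} (ht : 0 < t) (hts : t < s)
    (hb : Metric.closedBall (x - s • u) s ⊆ F) : x - t • u ∈ interior F := by
  refine interior_mono hb (Metric.ball_subset_interior_closedBall ?_)
  rw [Metric.mem_ball, dist_eq_norm]
  have e : x - t • u - (x - s • u) = (s - t) • u := by rw [sub_smul]; abel
  rw [e, norm_smul, hu, Real.norm_of_nonneg (by linarith)]
  linarith

/-- A point y of F* avoids the open ball of radius s. Scaling that inequality by t/s cancels the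
linear term and leaves the factor 1 − t/s, positive because t < s. -/
theorem inner_growth (hu : ‖u‖ = 1) {s t : ℝ} (ht : 0 < t) (hts : t < s)
    (hb : Metric.closedBall (x - s • u) s ⊆ F) {y : E d} (hy : y ∈ coClosure F) :
    t ^ 2 + (1 - t / s) * ‖y - x‖ ^ 2 ≤ dist (x - t • u) y ^ 2 := by
  have hs : 0 < s := ht.trans hts
  have h1 : s ≤ ‖(y - x) + s • u‖ := by
    by_contra hcon
    push Not at hcon
    rw [coClosure, closure_compl] at hy
    refine hy (interior_mono hb (Metric.ball_subset_interior_closedBall ?_))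
    rw [Metric.mem_ball, dist_eq_norm]
    rwa [← sub_add]
  have h2 := (sq_le_sq₀ hs.le (norm_nonneg _)).2 h1
  rw [norm_add_smul_sq hu] at h2
  have e : x - t • u - y = -((y - x) + t • u) := by abel
  rw [dist_eq_norm, e, norm_neg, norm_add_smul_sq hu]
  have h3 : 0 ≤ t / s * (‖y - x‖ ^ 2 + 2 * s * inner ℝ (y - x) u) :=
    mul_nonneg (by positivity) (by linarith)
  have h4 : t / s * (‖y - x‖ ^ 2 + 2 * s * inner ℝ (y - x) u) =
      t / s * ‖y - x‖ ^ 2 + 2 * t * inner ℝ (y - x) u := by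
    field_simp
  nlinarith

theorem dist_sub_smul (hu : ‖u‖ = 1) {t : ℝ} (ht : 0 ≤ t) : dist (x - t • u) x = t := by
  rw [dist_eq_norm, sub_sub_cancel_left, norm_neg, norm_smul, hu, Real.norm_of_nonneg ht, mul_one]

theorem inner_of_closedBall (hu : ‖u‖ = 1) {s t : ℝ} (ht : 0 < t) (hts : t < s)
    (hb : Metric.closedBall (x - s • u) s ⊆ F) (hx : x ∈ coClosure F) :
    Metric.infDist (x - t • u) (coClosure F) = t ∧ proj (coClosure F) (x - t • u) = x ∧
      dir (coClosure F) (x - t • u) = -u ∧ x - t • u ∉ skeleton (coClosure F) := by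
  have hs : 0 < s := ht.trans hts
  have hc : 0 < 1 - t / s := by rw [sub_pos, div_lt_one hs]; exact hts
  obtain ⟨h1, h2, h3⟩ := unique_nearest_of_quadratic_growth hc hx
    (dist_sub_smul hu ht.le) fun y hy => inner_growth hu ht hts hb hy
  refine ⟨h1, h2, ?_, h3⟩
  rw [dir, h1, h2, sub_sub_cancel_left, smul_neg, smul_smul, inv_mul_cancel₀ ht.ne', one_smul]

theorem inner_notMem_skeleton_frontier (hu : ‖u‖ = 1) {s t : ℝ} (ht : 0 < t) (hts : t < s)
    (hb : Metric.closedBall (x - s • u) s ⊆ F) (hx : x ∈ frontier F) :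
    x - t • u ∉ skeleton (frontier F) := by
  have hs : 0 < s := ht.trans hts
  have hc : 0 < 1 - t / s := by rw [sub_pos, div_lt_one hs]; exact hts
  refine (unique_nearest_of_quadratic_growth hc hx
    (dist_sub_smul hu ht.le) fun y hy => inner_growth hu ht hts hb ?_).2.2
  rw [frontier_eq_closure_inter_closure] at hy
  exact hy.2

/-- At interior points of a closed convex set, the metric projection to
the closed complement provides normals and inner tangent balls. -/
theorem isNormal_proj_coClosure (hF : IsClosed F) (hconv : Convex ℝ F)
    (hne : (coClosure F).Nonempty) (hz : z ∉ coClosure F) :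
    IsNormal F (proj (coClosure F) z) (-dir (coClosure F) z) ∧
      HasInnerBall F (proj (coClosure F) z) (-dir (coClosure F) z) := by
  have hcl : IsClosed (coClosure F) := isClosed_closure
  have hzi : z ∈ interior F := by
    rw [coClosure, closure_compl] at hz
    simpa using hz
  have hr := infDist_pos_of_notMem hcl hne hz
  obtain ⟨hm, hd⟩ := isNearest_proj hcl hne z
  have hz' := proj_add_smul_dir hr
  have hnorm := norm_dir hcl hne hz
  set x := proj (coClosure F) z
  set v := dir (coClosure F) z
  set r := Metric.infDist z (coClosure F) with hrdef
  have hball : Metric.ball z r ⊆ F := by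
    intro y hy
    by_contra hcon
    have := Metric.infDist_le_dist_of_mem (x := z) (subset_closure hcon : y ∈ coClosure F)
    rw [Metric.mem_ball, dist_comm] at hy
    exact absurd hy (not_lt.2 this)
  have hcb : Metric.closedBall z r ⊆ F := by
    rw [← closure_ball z hr.ne']
    exact closure_minimal hball hF
  have hxF : x ∈ F := hcb (by rw [Metric.mem_closedBall, dist_comm, hd])
  have hb : Metric.closedBall (x - r • (-v)) r ⊆ F := by
    rwa [smul_neg, sub_neg_eq_add, hz']
  have hxf : x ∈ frontier F := by
    rw [frontier_eq_closure_inter_closure]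
    exact ⟨subset_closure hxF, hm⟩
  -- Some supporting normal exists at x, and the touching ball leaves only one candidate.
  obtain ⟨w, hw⟩ := exists_isNormal_of_mem_frontier hF hconv ⟨z, hzi⟩ hxf
  have := hw.eq_of_closedBall hr (by rwa [norm_neg]) hb
  exact ⟨this ▸ hw, r, hr, hb⟩

/-! ### The normal bundle and the regular points of a convex body -/

theorem normals_eq (hF : IsClosed F) (hconv : Convex ℝ F) (hne : F.Nonempty) (x : E d) :
    normals F x = {u | IsNormal F x u} := by
  ext u
  constructor
  · rintro ⟨z, hz, rfl, rfl⟩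
    exact isNormal_proj hF hconv hne fun h => hz (Or.inr h)
  · intro h
    obtain ⟨-, h2, h3, h4⟩ := h.outer one_pos
    exact ⟨x + (1 : ℝ) • u, fun hm => hm.elim h4 (h.notMem one_pos), h2, h3⟩

theorem isNormal_of_mem_normals_coClosure (hF : IsClosed F) (hconv : Convex ℝ F)
    (hne : (coClosure F).Nonempty) (hu : u ∈ normals (coClosure F) x) :
    IsNormal F x (-u) ∧ HasInnerBall F x (-u) := by
  obtain ⟨z, hz, rfl, rfl⟩ := hu
  exact isNormal_proj_coClosure hF hconv hne fun h => hz (Or.inr h)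

/-- Reversed normals of F* are already supporting normals of F, so F* contributes nothing new. -/
theorem NorE_eq (hF : IsClosed F) (hconv : Convex ℝ F) (hne : F.Nonempty)
    (hne' : (coClosure F).Nonempty) : NorE F = {q | IsNormal F q.1 q.2} := by
  ext ⟨x, u⟩
  constructor
  · rintro (⟨-, h⟩ | ⟨⟨y, v⟩, ⟨-, h⟩, heq⟩)
    · rwa [normals_eq hF hconv hne] at h
    · obtain ⟨rfl, rfl⟩ := Prod.ext_iff.1 heq
      exact (isNormal_of_mem_normals_coClosure hF hconv hne' h).1
  · intro h
    refine Or.inl ⟨IsNormal.mem_frontier h, ?_⟩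
    rw [normals_eq hF hconv hne]
    exact h

/-- Two antipodal normals would confine F to a hyperplane. -/
theorem IsNormal.not_neg (hint : (interior F).Nonempty) (h : IsNormal F x u) :
    ¬ IsNormal F x (-u) := by
  intro h'
  obtain ⟨y, hy⟩ := hint
  have h0 : ∀ w ∈ F, inner ℝ (w - x) u = 0 := fun w hw =>
    le_antisymm (h.2.2 w hw) (by simpa [inner_neg_right] using h'.2.2 w hw)
  obtain ⟨r, hr, hb⟩ := Metric.nhds_basis_closedBall.mem_iff.1 (mem_interior_iff_mem_nhds.1 hy)
  have h1 := h0 y (interior_subset hy)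
  have h2 := h0 (y + r • u) (hb (by
    rw [Metric.mem_closedBall, dist_add_smul h.2.1 hr.le]))
  have e : y + r • u - x = (y - x) + r • u := by abel
  rw [e, inner_add_left, h1, inner_smul_left, real_inner_self_eq_norm_sq, h.2.1] at h2
  simp at h2
  exact hr.ne' h2

/-- The antipodal case is impossible for F, and a normal of F* at x comes with an inner ball, which
makes the normal of F unique. -/
theorem regE_eq (hF : IsClosed F) (hconv : Convex ℝ F) (hint : (interior F).Nonempty)
    (hne' : (coClosure F).Nonempty) : regE F = {x | ∃! u, IsNormal F x u} := by
  have hne : F.Nonempty := hint.mono interior_subset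
  ext x
  constructor
  · rintro (⟨-, u, h⟩ | ⟨-, u, h⟩)
    · rw [normals_eq hF hconv hne] at h
      have hset : {v | IsNormal F x v} = {u} := by
        rcases h with h | h
        · exact h
        · exfalso
          have hu : IsNormal F x u := h.ge (mem_insert _ _)
          exact hu.not_neg hint (h.ge (mem_insert_of_mem _ rfl))
      exact ⟨u, hset.ge rfl, fun v hv => hset.le hv⟩
    · have hu : u ∈ normals (coClosure F) x := by
        rcases h with h | h <;> rw [h] <;> simp
      obtain ⟨h1, r, hr, hb⟩ := isNormal_of_mem_normals_coClosure hF hconv hne' hu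
      exact ⟨-u, h1, fun v hv => IsNormal.eq_of_closedBall hv hr h1.2.1 hb⟩
  · rintro ⟨u, hu, huniq⟩
    refine Or.inl ⟨IsNormal.mem_frontier hu, u, Or.inl ?_⟩
    rw [normals_eq hF hconv hne]
    ext v
    exact ⟨fun hv => huniq v hv, fun hv => hv ▸ hu⟩

theorem isNormal_nu (hNor : NorE F = {q | IsNormal F q.1 q.2}) (h : ∃ u, IsNormal F x u) :
    IsNormal F x (nu F x) := by
  have h' : ∃ u, (x, u) ∈ NorE F := by
    obtain ⟨u, hu⟩ := h
    exact ⟨u, hNor.ge hu⟩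
  exact hNor.le (Classical.epsilon_spec h')

/-! ### Topological properties of the normal bundle -/

theorem isClosed_setOf_isNormal (hF : IsClosed F) :
    IsClosed {q : E d × E d | IsNormal F q.1 q.2} := by
  have : {q : E d × E d | IsNormal F q.1 q.2} =
      {q | q.1 ∈ F} ∩ ({q | ‖q.2‖ = 1} ∩ ⋂ y ∈ F, {q | inner ℝ (y - q.1) q.2 ≤ 0}) := by
    ext q
    simp [IsNormal]
  rw [this]
  refine (hF.preimage continuous_fst).inter ((isClosed_eq (by fun_prop) (by fun_prop)).inter
    (isClosed_biInter fun y _ => isClosed_le (by fun_prop) (by fun_prop)))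

theorem isCompact_setOf_isNormal (hF : IsCompact F) :
    IsCompact {q : E d × E d | IsNormal F q.1 q.2} := by
  refine (hF.prod (isCompact_sphere (0 : E d) 1)).of_isClosed_subset
    (isClosed_setOf_isNormal hF.isClosed) fun q hq => ⟨hq.1, ?_⟩
  simpa using hq.2.1

/-- Normals converge to the normal at a point with a unique normal. -/
theorem tendsto_normal (hF : IsClosed F) (huniq : ∀ v, IsNormal F x v → v = u)
    {ι : Type*} {l : Filter ι} {a b : ι → E d} (ha : Tendsto a l (𝓝 x))
    (hab : ∀ᶠ i in l, IsNormal F (a i) (b i)) : Tendsto b l (𝓝 u) := by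
  refine (isCompact_sphere (0 : E d) 1).tendsto_nhds_of_unique_mapClusterPt
    (hab.mono fun i hi => by simpa using hi.2.1) fun v _ hv => huniq v ?_
  obtain ⟨U, hU, hUv⟩ := mapClusterPt_iff_ultrafilter.1 hv
  have h1 : Tendsto (fun i => (a i, b i)) U (𝓝 (x, v)) := (ha.mono_left hU).prodMk_nhds hUv
  exact (isClosed_setOf_isNormal hF).mem_of_tendsto h1 (hU hab)

/-- Pairs of normals at one point at distance at least 1/(n+1) form a compact set, so the points
with several normals are σ-compact. -/
theorem measurableSet_setOf_existsUnique_isNormal (hF : IsCompact F) :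
    MeasurableSet {x | ∃! u, IsNormal F x u} := by
  set N := {q : E d × E d | IsNormal F q.1 q.2}
  have hN : IsCompact N := isCompact_setOf_isNormal hF
  let P : ℕ → Set ((E d × E d) × (E d × E d)) := fun n =>
    (N ×ˢ N) ∩ {p | p.1.1 = p.2.1 ∧ 1 / ((n : ℝ) + 1) ≤ ‖p.1.2 - p.2.2‖}
  have hP : ∀ n, IsCompact (P n) := fun n => by
    refine (hN.prod hN).inter_right (IsClosed.and ?_ ?_)
    · exact isClosed_eq (by fun_prop) (by fun_prop)
    · exact isClosed_le (by fun_prop) (by fun_prop)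
  have heq : {x | ∃! u, IsNormal F x u} =
      (Prod.fst '' N) \ ⋃ n, (fun p => p.1.1) '' P n := by
    ext x
    constructor
    · rintro ⟨u, hu, huniq⟩
      refine ⟨⟨(x, u), hu, rfl⟩, fun hm => ?_⟩
      obtain ⟨n, ⟨⟨y, v⟩, ⟨y', w⟩⟩, ⟨⟨h1, h2⟩, h3, h4⟩, h5⟩ := mem_iUnion.1 hm
      dsimp only at h3 h4 h5
      subst h5
      subst h3
      rw [huniq v h1, huniq w h2, sub_self, norm_zero] at h4
      have : (0 : ℝ) < 1 / ((n : ℝ) + 1) := by positivity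
      linarith
    · rintro ⟨⟨⟨y, u⟩, hu, rfl⟩, hm⟩
      refine ⟨u, hu, fun v hv => ?_⟩
      by_contra hne
      obtain ⟨n, hn⟩ := exists_nat_one_div_lt (norm_pos_iff.2 (sub_ne_zero.2 hne))
      exact hm (mem_iUnion.2 ⟨n, ⟨⟨(y, v), (y, u)⟩, ⟨⟨hv, hu⟩, rfl, hn.le⟩, rfl⟩⟩)
  rw [heq]
  refine (hN.image continuous_fst).measurableSet.diff (MeasurableSet.iUnion fun n => ?_)
  exact ((hP n).image (by fun_prop)).measurableSet

theorem continuousOn_nu (hF : IsClosed F) (hNor : NorE F = {q | IsNormal F q.1 q.2}) :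
    ContinuousOn (nu F) {x | ∃! u, IsNormal F x u} := by
  intro x hx
  refine tendsto_normal hF (fun v hv => ?_) (a := id) (tendsto_id.mono_left nhdsWithin_le_nhds)
    (eventually_mem_nhdsWithin.mono fun y hy => isNormal_nu hNor hy.exists)
  exact hx.unique hv (isNormal_nu hNor hx.exists)

/-! ### Graph charts of the boundary -/

/-- The orthogonal projection of `ℝᵈ` to the hyperplane orthogonal to `e`. -/
noncomputable def hyperproj (e : E d) : E d →L[ℝ] (Submodule.span ℝ {e})ᗮ :=
  (Submodule.span ℝ {e})ᗮ.orthogonalProjectionOnto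

theorem coe_hyperproj {e : E d} (he : ‖e‖ = 1) (w : E d) :
    (hyperproj e w : E d) = w - inner ℝ w e • e := by
  have h := Submodule.starProjection_orthogonal_val (𝕜 := ℝ) (K := Submodule.span ℝ {e}) w
  rw [Submodule.starProjection_unit_singleton ℝ he, real_inner_comm] at h
  exact h

theorem inner_eq_hyperproj {e : E d} (he : ‖e‖ = 1) (v w : E d) :
    inner ℝ v w = inner ℝ (hyperproj e v) (hyperproj e w) + inner ℝ v e * inner ℝ w e := by
  rw [Submodule.coe_inner, coe_hyperproj he, coe_hyperproj he]
  simp only [inner_sub_left, inner_sub_right, inner_smul_left, inner_smul_right,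
    real_inner_self_eq_norm_sq, he, conj_trivial, real_inner_comm e]
  rw [real_inner_comm w e]
  ring

theorem norm_hyperproj_le (e w : E d) : ‖hyperproj e w‖ ≤ ‖w‖ :=
  Submodule.norm_orthogonalProjectionOnto_apply_le _ _

theorem norm_le_hyperproj {e : E d} (he : ‖e‖ = 1) (w : E d) :
    ‖w‖ ≤ ‖hyperproj e w‖ + |inner ℝ w e| := by
  have h : w = (hyperproj e w : E d) + inner ℝ w e • e := by rw [coe_hyperproj he]; abel
  calc ‖w‖ = ‖(hyperproj e w : E d) + inner ℝ w e • e‖ := by rw [← h]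
    _ ≤ ‖(hyperproj e w : E d)‖ + ‖inner ℝ w e • e‖ := norm_add_le _ _
    _ = _ := by rw [norm_smul, he, mul_one, Real.norm_eq_abs]; rfl

/-- The pairs `(x, u)` of a boundary point and a normal with `⟨u, e⟩ > 1/2`. -/
def chartNor (F : Set (E d)) (e : E d) : Set (E d × E d) :=
  {q | IsNormal F q.1 q.2 ∧ 1 / 2 < inner ℝ q.2 e}

/-- The supporting inequality at p bounds ⟨q.1 − p.1, e⟩⟨p.2, e⟩ by the horizontal distance; the 2
comes from ⟨p.2, e⟩ > 1/2. Adding the horizontal part yields the 3 of the next lemma. -/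
theorem inner_le_two_mul_norm_hyperproj {e : E d} (he : ‖e‖ = 1) {p q : E d × E d}
    (hp : p ∈ chartNor F e) (hq : q ∈ chartNor F e) :
    inner ℝ (q.1 - p.1) e ≤ 2 * ‖hyperproj e q.1 - hyperproj e p.1‖ := by
  have h1 := hp.1.2.2 _ hq.1.1
  rw [inner_eq_hyperproj he, map_sub] at h1
  have h2 := abs_real_inner_le_norm (hyperproj e q.1 - hyperproj e p.1) (hyperproj e p.2)
  have h3 : ‖hyperproj e p.2‖ ≤ 1 := hp.1.2.1 ▸ norm_hyperproj_le e p.2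
  have h4 := (abs_le.1 h2).1
  have h5 := mul_le_mul_of_nonneg_left h3 (norm_nonneg (hyperproj e q.1 - hyperproj e p.1))
  by_contra hcon
  push Not at hcon
  have h6 : 0 < inner ℝ (q.1 - p.1) e :=
    lt_of_le_of_lt (by positivity) hcon
  nlinarith [mul_lt_mul_of_pos_left hp.2 h6]

theorem norm_sub_le_three_mul_norm_hyperproj {e : E d} (he : ‖e‖ = 1) {p q : E d × E d}
    (hp : p ∈ chartNor F e) (hq : q ∈ chartNor F e) :
    ‖q.1 - p.1‖ ≤ 3 * ‖hyperproj e q.1 - hyperproj e p.1‖ := by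
  have h1 := inner_le_two_mul_norm_hyperproj he hp hq
  have h2 := inner_le_two_mul_norm_hyperproj he hq hp
  rw [← neg_sub, inner_neg_left, norm_sub_rev] at h2
  have h3 : |inner ℝ (q.1 - p.1) e| ≤ 2 * ‖hyperproj e q.1 - hyperproj e p.1‖ :=
    abs_le.2 ⟨by linarith, h1⟩
  have h4 := norm_le_hyperproj he (q.1 - p.1)
  rw [map_sub] at h4
  linarith

theorem finrank_orthogonal_span (hd : 1 ≤ d) {e : E d} (he : ‖e‖ = 1) :
    Module.finrank ℝ (Submodule.span ℝ {e})ᗮ = d - 1 := by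
  have : Fact (Module.finrank ℝ (E d) = d - 1 + 1) := ⟨by rw [finrank_euclideanSpace_fin]; omega⟩
  exact Submodule.finrank_orthogonal_span_singleton (norm_ne_zero_iff.1 (by rw [he]; exact one_ne_zero))

theorem _root_.LipschitzOnWith.euclideanHausdorffMeasure_image_le {X Y : Type*} [EMetricSpace X]
    [EMetricSpace Y] [MeasurableSpace X] [BorelSpace X] [MeasurableSpace Y] [BorelSpace Y]
    {C : NNReal} {f : X → Y} {s : Set X} (h : LipschitzOnWith C f s) (n : ℕ) :
    (Measure.euclideanHausdorffMeasure n : Measure Y) (f '' s) ≤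
      (C : ℝ≥0∞) ^ (n : ℝ) * (Measure.euclideanHausdorffMeasure n : Measure X) s := by
  rw [Measure.euclideanHausdorffMeasure_def, Measure.euclideanHausdorffMeasure_def,
    Measure.smul_apply, Measure.smul_apply, mul_smul_comm]
  exact smul_le_smul_of_nonneg_left (h.hausdorffMeasure_image_le n.cast_nonneg) zero_le

/-- The inverse of the projection is 3-Lipschitz on a chart, and on the (d−1)-dimensional hyperplane
Hausdorff measure is volume. -/
theorem euclideanHausdorffMeasure_le_volume_hyperproj (hd : 1 ≤ d) {e : E d} (he : ‖e‖ = 1)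
    {A : Set (E d)} (hA : A ⊆ Prod.fst '' chartNor F e) :
    (Measure.euclideanHausdorffMeasure (d - 1) : Measure (E d)) A ≤
      ((3 : NNReal) : ℝ≥0∞) ^ ((d - 1 : ℕ) : ℝ) * volume (hyperproj e '' A) := by
  have hinj : ∀ a ∈ A, ∀ b ∈ A, dist a b ≤ 3 * dist (hyperproj e a) (hyperproj e b) := by
    intro a ha b hb
    obtain ⟨p, hp, rfl⟩ := hA ha
    obtain ⟨q, hq, rfl⟩ := hA hb
    rw [dist_eq_norm, dist_eq_norm]
    exact norm_sub_le_three_mul_norm_hyperproj he hq hp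
  have hinjOn : InjOn (hyperproj e) A := fun a ha b hb hab => by
    have := hinj a ha b hb
    rw [hab, dist_self, mul_zero] at this
    exact dist_le_zero.1 this
  have hl : LipschitzOnWith 3 (Function.invFunOn (hyperproj e) A) (hyperproj e '' A) := by
    refine LipschitzOnWith.of_dist_le_mul ?_
    rintro _ ⟨a, ha, rfl⟩ _ ⟨b, hb, rfl⟩
    rw [hinjOn.leftInvOn_invFunOn ha, hinjOn.leftInvOn_invFunOn hb]
    exact hinj a ha b hb
  have h := hl.euclideanHausdorffMeasure_image_le (d - 1)
  rw [hinjOn.leftInvOn_invFunOn.image_image] at h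
  have hv := InnerProductSpace.euclideanHausdorffMeasure_eq_volume
    (V := (Submodule.span ℝ {e})ᗮ)
  rw [finrank_orthogonal_span hd he] at hv
  rwa [hv] at h

/-- The normal directions are covered by finitely many charts. -/
theorem exists_finite_chart_cover (d : ℕ) : ∃ T : Finset (E d), (∀ e ∈ T, ‖e‖ = 1) ∧
    ∀ u : E d, ‖u‖ = 1 → ∃ e ∈ T, 1 / 2 < inner ℝ u e := by
  obtain ⟨T, hT, hc⟩ := (isCompact_sphere (0 : E d) 1).elim_nhds_subcover
    (fun e => {u | 1 / 2 < inner ℝ u e}) (fun e he => by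
      refine (isOpen_lt (by fun_prop) (by fun_prop)).mem_nhds ?_
      rw [mem_sphere_zero_iff_norm] at he
      rw [mem_ofPred_eq, real_inner_self_eq_norm_sq, he]
      norm_num)
  refine ⟨T, fun e he => mem_sphere_zero_iff_norm.1 (hT e he), fun u hu => ?_⟩
  have := hc (mem_sphere_zero_iff_norm.2 hu)
  simpa using this

theorem euclideanHausdorffMeasure_setOf_isNormal_lt_top (hd : 1 ≤ d) (hF : IsCompact F) :
    (Measure.euclideanHausdorffMeasure (d - 1) : Measure (E d)) {x | ∃ u, IsNormal F x u} < ⊤ := by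
  obtain ⟨T, hT, hc⟩ := exists_finite_chart_cover d
  have hsub : {x | ∃ u, IsNormal F x u} ⊆ ⋃ e ∈ T, Prod.fst '' chartNor F e := by
    rintro x ⟨u, hu⟩
    obtain ⟨e, he, h⟩ := hc u hu.2.1
    exact mem_biUnion he ⟨(x, u), ⟨hu, h⟩, rfl⟩
  refine (measure_mono hsub).trans_lt ((measure_biUnion_finset_le _ _).trans_lt ?_)
  refine ENNReal.sum_lt_top.2 fun e he => ?_
  refine (euclideanHausdorffMeasure_le_volume_hyperproj hd (hT e he) subset_rfl).trans_lt ?_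
  refine ENNReal.mul_lt_top (ENNReal.rpow_lt_top_of_nonneg (Nat.cast_nonneg _) (by simp)) ?_
  have hb : IsCompact (hyperproj e '' F) := hF.image (hyperproj e).continuous
  refine (measure_mono (image_mono ?_)).trans_lt hb.measure_lt_top
  rintro _ ⟨q, hq, rfl⟩
  exact hq.1.1

/-! ### Almost every boundary point has an inner tangent ball -/

/-- The Minty parametrization `y = x' + p` of the graph of the subdifferential of the convex
function that describes `F` in the direction `e`. -/
noncomputable def minty (e : E d) (q : E d × E d) : (Submodule.span ℝ {e})ᗮ :=
  hyperproj e q.1 + (inner ℝ q.2 e)⁻¹ • hyperproj e q.2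

/-- Scaled to have e-component 1, the normal is p + e with p the slope. -/
theorem inner_slope {e : E d} (he : ‖e‖ = 1) {p : E d × E d} (hp : p ∈ chartNor F e) (w : E d) :
    inner ℝ w ((inner ℝ p.2 e)⁻¹ • p.2) =
      inner ℝ (hyperproj e w) ((inner ℝ p.2 e)⁻¹ • hyperproj e p.2) + inner ℝ w e := by
  have h : inner ℝ p.2 e ≠ 0 := by
    have := hp.2
    intro h0
    rw [h0] at this
    norm_num at this
  rw [inner_smul_right, inner_smul_right, inner_eq_hyperproj he w p.2]
  field_simp

/-- In the sum of the supporting inequalities at p and q the e-components cancel. -/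
theorem minty_monotone {e : E d} (he : ‖e‖ = 1) {p q : E d × E d}
    (hp : p ∈ chartNor F e) (hq : q ∈ chartNor F e) :
    0 ≤ inner ℝ (hyperproj e q.1 - hyperproj e p.1)
      ((inner ℝ q.2 e)⁻¹ • hyperproj e q.2 - (inner ℝ p.2 e)⁻¹ • hyperproj e p.2) := by
  have h1 : inner ℝ (q.1 - p.1) ((inner ℝ p.2 e)⁻¹ • p.2) ≤ 0 := by
    rw [inner_smul_right]
    have := hp.2
    exact mul_nonpos_of_nonneg_of_nonpos (inv_nonneg.2 (by linarith)) (hp.1.2.2 _ hq.1.1)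
  have h2 : inner ℝ (p.1 - q.1) ((inner ℝ q.2 e)⁻¹ • q.2) ≤ 0 := by
    rw [inner_smul_right]
    have := hq.2
    exact mul_nonpos_of_nonneg_of_nonpos (inv_nonneg.2 (by linarith)) (hq.1.2.2 _ hp.1.1)
  rw [← neg_sub, inner_neg_left, inner_slope he hq, map_sub] at h2
  rw [inner_slope he hp, map_sub] at h1
  rw [inner_sub_right]
  linarith

theorem norm_hyperproj_sub_le_minty {e : E d} (he : ‖e‖ = 1) {p q : E d × E d}
    (hp : p ∈ chartNor F e) (hq : q ∈ chartNor F e) :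
    ‖hyperproj e q.1 - hyperproj e p.1‖ ≤ ‖minty e q - minty e p‖ := by
  have h := minty_monotone he hp hq
  set a := hyperproj e q.1 - hyperproj e p.1
  set b := (inner ℝ q.2 e)⁻¹ • hyperproj e q.2 - (inner ℝ p.2 e)⁻¹ • hyperproj e p.2 with hb
  have e1 : minty e q - minty e p = a + b := by
    simp only [minty, a, hb]; abel
  rw [e1, ← sq_le_sq₀ (norm_nonneg _) (norm_nonneg _), norm_add_sq_real]
  nlinarith [sq_nonneg ‖b‖]

/-- The Lipschitz left inverse of the Minty parametrization. -/
noncomputable def mintyInv (F : Set (E d)) (e : E d) (y : (Submodule.span ℝ {e})ᗮ) :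
    (Submodule.span ℝ {e})ᗮ :=
  hyperproj e (Function.invFunOn (minty e) (chartNor F e) y).1

/-- The chosen preimage may differ from q, but equal parameters have equal base projections. -/
theorem mintyInv_minty {e : E d} (he : ‖e‖ = 1) {q : E d × E d} (hq : q ∈ chartNor F e) :
    mintyInv F e (minty e q) = hyperproj e q.1 := by
  have hex : ∃ p ∈ chartNor F e, minty e p = minty e q := ⟨q, hq, rfl⟩
  have h := norm_hyperproj_sub_le_minty he hq (Function.invFunOn_mem hex)
  rw [Function.invFunOn_eq hex, sub_self, norm_zero] at h
  exact sub_eq_zero.1 (norm_le_zero_iff.1 h)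

theorem lipschitzOnWith_mintyInv {e : E d} (he : ‖e‖ = 1) :
    LipschitzOnWith 1 (mintyInv F e) (minty e '' chartNor F e) := by
  refine LipschitzOnWith.of_dist_le_mul ?_
  rintro _ ⟨p, hp, rfl⟩ _ ⟨q, hq, rfl⟩
  rw [mintyInv_minty he hp, mintyInv_minty he hq, dist_eq_norm, dist_eq_norm, NNReal.coe_one,
    one_mul]
  exact norm_hyperproj_sub_le_minty he hq hp

/-- A map that is differentiable within `s` with invertible derivative is bounded below near the
base point. -/
theorem _root_.HasFDerivWithinAt.exists_norm_sub_le_of_det_ne_zero {V : Type*} [NormedAddCommGroup V]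
    [NormedSpace ℝ V] [FiniteDimensional ℝ V] {f : V → V} {A : V →L[ℝ] V} {s : Set V} {y : V}
    (hf : HasFDerivWithinAt f A s y) (hA : A.det ≠ 0) :
    ∃ C : ℝ, 0 < C ∧ ∀ᶠ y' in 𝓝[s] y, ‖y' - y‖ ≤ C * ‖f y' - f y‖ := by
  let B := A.toContinuousLinearEquivOfDetNeZero hA
  obtain ⟨K, hK, hanti⟩ : ∃ K : ℝ, 0 < K ∧ ∀ v, ‖v‖ ≤ K * ‖A v‖ := by
    refine ⟨‖(B.symm : V →L[ℝ] V)‖ + 1, by positivity, fun v => ?_⟩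
    have h1 : (B.symm : V →L[ℝ] V) (A v) = v := B.symm_apply_apply v
    calc ‖v‖ = ‖(B.symm : V →L[ℝ] V) (A v)‖ := by rw [h1]
      _ ≤ ‖(B.symm : V →L[ℝ] V)‖ * ‖A v‖ := ContinuousLinearMap.le_opNorm _ _
      _ ≤ _ := by gcongr; linarith
  -- With remainder 1/(2K), multiplication by K costs only half of ‖y' − y‖, which is absorbed on
  -- the left.
  have ho := (hasFDerivWithinAt_iff_isLittleO.1 hf).bound (c := 1 / (2 * K)) (by positivity)
  refine ⟨2 * K, by positivity, ho.mono fun y' hy' => ?_⟩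
  have h1 := hanti (y' - y)
  have h2 : ‖A (y' - y)‖ ≤ ‖f y' - f y‖ + 1 / (2 * K) * ‖y' - y‖ := by
    have e1 : A (y' - y) = (f y' - f y) - (f y' - f y - A (y' - y)) := by abel
    calc ‖A (y' - y)‖ = ‖(f y' - f y) - (f y' - f y - A (y' - y))‖ := by rw [← e1]
      _ ≤ ‖f y' - f y‖ + ‖f y' - f y - A (y' - y)‖ := norm_sub_le _ _
      _ ≤ _ := by gcongr
  have h3 := mul_le_mul_of_nonneg_left h2 hK.le
  have h4 : K * (‖f y' - f y‖ + 1 / (2 * K) * ‖y' - y‖) =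
      K * ‖f y' - f y‖ + ‖y' - y‖ / 2 := by field_simp
  linarith

/-- If the Minty parametrization is controlled by the boundary points, the boundary deviates at
most quadratically from the supporting hyperplane. -/
theorem inner_sub_ge_of_minty {e : E d} (he : ‖e‖ = 1) {p q : E d × E d}
    (hp : p ∈ chartNor F e) (hq : q ∈ chartNor F e) {C : ℝ} (hC : 0 < C)
    (h : ‖minty e q - minty e p‖ ≤ C * ‖hyperproj e q.1 - hyperproj e p.1‖) :
    -((C + 1) * ‖q.1 - p.1‖ ^ 2) ≤ inner ℝ (q.1 - p.1) p.2 := by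
  have hpe := hp.2
  have hqe := hq.2
  have hpe1 : inner ℝ p.2 e ≤ 1 := by
    have := real_inner_le_norm p.2 e
    rwa [hp.1.2.1, he, mul_one] at this
  have h1 : 0 ≤ inner ℝ (q.1 - p.1) ((inner ℝ q.2 e)⁻¹ • q.2) := by
    rw [inner_smul_right]
    refine mul_nonneg (inv_nonneg.2 (by linarith)) ?_
    have := hq.1.2.2 _ hp.1.1
    rw [← neg_sub, inner_neg_left] at this
    linarith
  have h2 : inner ℝ (q.1 - p.1) ((inner ℝ p.2 e)⁻¹ • p.2) =
      (inner ℝ p.2 e)⁻¹ * inner ℝ (q.1 - p.1) p.2 := inner_smul_right _ _ _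
  rw [inner_slope he hp, map_sub] at h2
  rw [inner_slope he hq, map_sub] at h1
  have hw := norm_hyperproj_le e (q.1 - p.1)
  rw [map_sub] at hw
  set a := hyperproj e q.1 - hyperproj e p.1 with ha
  set b := (inner ℝ p.2 e)⁻¹ • hyperproj e p.2 with hb
  set b' := (inner ℝ q.2 e)⁻¹ • hyperproj e q.2 with hb'
  have e1 : b' - b = (minty e q - minty e p) - a := by
    simp only [minty, ha, hb, hb']; abel
  -- The change of slope is the change of the Minty parameter minus the change of the base point.
  have h3 : ‖b' - b‖ ≤ (C + 1) * ‖a‖ := by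
    rw [e1]
    refine (norm_sub_le _ _).trans ?_
    linarith
  have h4 := real_inner_le_norm a (b' - b)
  rw [inner_sub_right] at h4
  have h5 := mul_le_mul_of_nonneg_left h3 (norm_nonneg a)
  have h6 : ‖a‖ ^ 2 ≤ ‖q.1 - p.1‖ ^ 2 := by gcongr
  have h7 : -((C + 1) * ‖q.1 - p.1‖ ^ 2) ≤ (inner ℝ p.2 e)⁻¹ * inner ℝ (q.1 - p.1) p.2 := by
    nlinarith [mul_le_mul_of_nonneg_left h6 (by linarith : 0 ≤ C + 1)]
  have h8 : inner ℝ (q.1 - p.1) p.2 =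
      inner ℝ p.2 e * ((inner ℝ p.2 e)⁻¹ * inner ℝ (q.1 - p.1) p.2) := by
    have : inner ℝ p.2 e ≠ 0 := by linarith
    field_simp
  rw [h8]
  have h9 : 0 ≤ (C + 1) * ‖q.1 - p.1‖ ^ 2 := by positivity
  nlinarith [mul_le_mul_of_nonneg_left h7 (by linarith : 0 ≤ inner ℝ p.2 e)]

/-- Quadratic control of all nearby normals yields an inner tangent ball. -/
theorem hasInnerBall_of_quadratic (hF : IsClosed F) (hconv : Convex ℝ F) (hx : IsNormal F x u)
    (huniq : ∀ v, IsNormal F x v → v = u) {C : ℝ} (hC : 0 < C)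
    (h : ∀ {l : Filter ℝ} {a b : ℝ → E d}, Tendsto a l (𝓝 x) → Tendsto b l (𝓝 u) →
      (∀ᶠ r in l, IsNormal F (a r) (b r)) →
      ∀ᶠ r in l, -(C * ‖a r - x‖ ^ 2) ≤ inner ℝ (a r - x) u) :
    HasInnerBall F x u := by
  have hne : F.Nonempty := ⟨x, hx.1⟩
  by_contra hcon
  -- If no ball fits, each radius r > 0 yields a point q r of the ball outside F; its projection to
  -- F supplies normals converging to u.
  have hq : ∀ r : ℝ, ∃ q, 0 < r → q ∈ Metric.closedBall (x - r • u) r ∧ q ∉ F := by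
    intro r
    by_cases hr : 0 < r
    · have : ¬ Metric.closedBall (x - r • u) r ⊆ F := fun hs => hcon ⟨r, hr, hs⟩
      obtain ⟨q, hq1, hq2⟩ := not_subset.1 this
      exact ⟨q, fun _ => ⟨hq1, hq2⟩⟩
    · exact ⟨0, fun h => absurd h hr⟩
  choose q hq using hq
  have hpos : ∀ᶠ r : ℝ in 𝓝[>] 0, 0 < r := eventually_mem_nhdsWithin
  have hab : ∀ᶠ r in 𝓝[>] (0 : ℝ), IsNormal F (proj F (q r)) (dir F (q r)) :=
    hpos.mono fun r hr => isNormal_proj hF hconv hne (hq r hr).2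
  have hnear : ∀ r : ℝ, 0 < r → ‖proj F (q r) - x‖ ≤ ‖q r - x‖ := by
    intro r hr
    have hn := isNormal_proj hF hconv hne (hq r hr).2
    have hs := infDist_pos_of_notMem hF hne (hq r hr).2
    have hg := hn.growth hs.le hx.1
    rw [proj_add_smul_dir hs, one_mul, dist_eq_norm, norm_sub_rev] at hg
    rw [← sq_le_sq₀ (norm_nonneg _) (norm_nonneg _)]
    nlinarith [sq_nonneg (Metric.infDist (q r) F)]
  have hqx : ∀ r : ℝ, 0 < r → ‖q r - x‖ ≤ 2 * r := by
    intro r hr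
    have h1 := (hq r hr).1
    rw [Metric.mem_closedBall, dist_eq_norm] at h1
    have e1 : q r - x = (q r - (x - r • u)) + (-(r • u)) := by abel
    rw [e1]
    refine (norm_add_le _ _).trans ?_
    rw [norm_neg, norm_smul, hx.2.1, Real.norm_of_nonneg hr.le]
    linarith
  have ha : Tendsto (fun r => proj F (q r)) (𝓝[>] (0 : ℝ)) (𝓝 x) := by
    rw [tendsto_iff_norm_sub_tendsto_zero]
    have h0 : Tendsto (fun r : ℝ => 2 * r) (𝓝[>] 0) (𝓝 0) := by
      have : Tendsto (fun r : ℝ => 2 * r) (𝓝 0) (𝓝 (2 * 0)) := Continuous.tendsto (by fun_prop) 0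
      rw [mul_zero] at this
      exact this.mono_left nhdsWithin_le_nhds
    refine tendsto_of_tendsto_of_tendsto_of_le_of_le' tendsto_const_nhds h0
      (Eventually.of_forall fun r => norm_nonneg _)
      (hpos.mono fun r hr => (hnear r hr).trans (hqx r hr))
  have hb := tendsto_normal hF huniq ha hab
  have hinner : ∀ᶠ r in 𝓝[>] (0 : ℝ), 0 < inner ℝ (dir F (q r)) u := by
    have h1 : Tendsto (fun r => inner ℝ (dir F (q r)) u) (𝓝[>] (0 : ℝ)) (𝓝 (inner ℝ u u)) :=
      hb.inner tendsto_const_nhds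
    refine h1.eventually_const_lt ?_
    rw [real_inner_self_eq_norm_sq, hx.2.1]
    norm_num
  have hsmall : ∀ᶠ r in 𝓝[>] (0 : ℝ), r < 1 / (2 * C) :=
    (eventually_lt_nhds (by positivity)).filter_mono nhdsWithin_le_nhds
  -- For r < 1/(2C) the ball condition ‖q − x‖² ≤ −2r⟨q − x, u⟩ contradicts ⟨q − x, u⟩ > −C‖q − x‖².
  obtain ⟨r, hr, h1, h2, h3⟩ := (hpos.and ((h ha hb hab).and (hinner.and hsmall))).exists
  have hs := infDist_pos_of_notMem hF hne (hq r hr).2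
  have hz := proj_add_smul_dir hs
  have h4 : inner ℝ (q r - x) u =
      inner ℝ (proj F (q r) - x) u + Metric.infDist (q r) F * inner ℝ (dir F (q r)) u := by
    have e1 : q r - x = (proj F (q r) - x) + Metric.infDist (q r) F • dir F (q r) := by
      conv_lhs => rw [← hz]
      abel
    rw [e1, inner_add_left, inner_smul_left]
    simp
  have h5 := mul_pos hs h2
  have h6 : ‖q r - x‖ ^ 2 + 2 * r * inner ℝ (q r - x) u ≤ 0 := by
    rw [← mem_closedBall_sub_smul hx.2.1 hr.le, add_sub_cancel]
    exact (hq r hr).1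
  have h7 : ‖proj F (q r) - x‖ ^ 2 ≤ ‖q r - x‖ ^ 2 := by
    have := hnear r hr
    gcongr
  have h8 : -(C * ‖q r - x‖ ^ 2) < inner ℝ (q r - x) u := by
    nlinarith [mul_le_mul_of_nonneg_left h7 hC.le]
  have h9 : 2 * r * C < 1 := by
    rw [lt_div_iff₀ (by positivity)] at h3
    linarith
  nlinarith [mul_lt_mul_of_pos_left h8 (by positivity : 0 < 2 * r), sq_nonneg ‖q r - x‖,
    mul_nonneg (sub_nonneg.2 h9.le) (sq_nonneg ‖q r - x‖)]

theorem hasInnerBall_of_minty (hF : IsClosed F) (hconv : Convex ℝ F) {e : E d} (he : ‖e‖ = 1)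
    (hx : (x, u) ∈ chartNor F e) (huniq : ∀ v, IsNormal F x v → v = u) {C : ℝ} (hC : 0 < C)
    (h : ∀ᶠ y in 𝓝[minty e '' chartNor F e] (minty e (x, u)),
      ‖y - minty e (x, u)‖ ≤ C * ‖mintyInv F e y - mintyInv F e (minty e (x, u))‖) :
    HasInnerBall F x u := by
  refine hasInnerBall_of_quadratic hF hconv hx.1 huniq (by linarith : 0 < C + 1) ?_
  intro l a b ha hb hab
  have hbe : Tendsto (fun r => inner ℝ (b r) e) l (𝓝 (inner ℝ u e)) :=
    hb.inner tendsto_const_nhds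
  have hue : 1 / 2 < inner ℝ u e := hx.2
  have hmem : ∀ᶠ r in l, (a r, b r) ∈ chartNor F e :=
    hab.and (hbe.eventually_const_lt hue)
  have hy : Tendsto (fun r => minty e (a r, b r)) l (𝓝[minty e '' chartNor F e] minty e (x, u)) := by
    refine tendsto_nhdsWithin_iff.2 ⟨?_, hmem.mono fun r hr => mem_image_of_mem _ hr⟩
    exact (((hyperproj e).continuous.tendsto x).comp ha).add
      ((hbe.inv₀ (by linarith)).smul (((hyperproj e).continuous.tendsto u).comp hb))
  filter_upwards [hy.eventually h, hmem] with r hr hmr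
  rw [mintyInv_minty he hmr, mintyInv_minty he hx] at hr
  exact inner_sub_ge_of_minty he hx hmr hC hr

/-- Every exceptional point projects to a value of `mintyInv` at a parameter of
non-differentiability (`N₁`, Rademacher) or of singular derivative (`N₂`, Sard). -/
theorem euclideanHausdorffMeasure_not_hasInnerBall (hd : 1 ≤ d) (hF : IsClosed F)
    (hconv : Convex ℝ F) :
    (Measure.euclideanHausdorffMeasure (d - 1) : Measure (E d))
      {x | ∃ u, IsNormal F x u ∧ (∀ v, IsNormal F x v → v = u) ∧ ¬ HasInnerBall F x u} = 0 := by
  obtain ⟨T, hT, hc⟩ := exists_finite_chart_cover d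
  have hsub : {x | ∃ u, IsNormal F x u ∧ (∀ v, IsNormal F x v → v = u) ∧ ¬ HasInnerBall F x u} ⊆
      ⋃ e ∈ T, {x | ∃ u, (x, u) ∈ chartNor F e ∧ (∀ v, IsNormal F x v → v = u) ∧
        ¬ HasInnerBall F x u} := by
    rintro x ⟨u, hu, h1, h2⟩
    obtain ⟨e, he, h⟩ := hc u hu.2.1
    exact mem_biUnion he ⟨u, ⟨hu, h⟩, h1, h2⟩
  refine measure_mono_null hsub ((measure_biUnion_null_iff T.countable_toSet).2 fun e heT => ?_)
  have he := hT e heT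
  set A := {x | ∃ u, (x, u) ∈ chartNor F e ∧ (∀ v, IsNormal F x v → v = u) ∧
        ¬ HasInnerBall F x u}
  suffices h : volume (hyperproj e '' A) = 0 by
    have hA : A ⊆ Prod.fst '' chartNor F e := fun x ⟨u, hu, _⟩ => ⟨(x, u), hu, rfl⟩
    have := euclideanHausdorffMeasure_le_volume_hyperproj hd he hA
    rw [h, mul_zero] at this
    exact le_antisymm this zero_le
  set Y := minty e '' chartNor F e
  let N₁ := {y | y ∈ Y ∧ ¬ DifferentiableWithinAt ℝ (mintyInv F e) Y y}
  let N₂ := {y | y ∈ Y ∧ DifferentiableWithinAt ℝ (mintyInv F e) Y y ∧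
    (fderivWithin ℝ (mintyInv F e) Y y).det = 0}
  have hlip : LipschitzOnWith 1 (mintyInv F e) Y := lipschitzOnWith_mintyInv he
  have hN₁ : volume (mintyInv F e '' N₁) = 0 := by
    have h0 : volume N₁ = 0 := by
      have := hlip.ae_differentiableWithinAt_of_mem (μ := volume)
      rw [ae_iff] at this
      convert this using 3
      simp
    -- Source and target are the same hyperplane, so a Lipschitz map sends null sets to null sets.
    have hl := (hlip.mono (fun y hy => hy.1 : N₁ ⊆ Y)).euclideanHausdorffMeasure_image_le
      (Module.finrank ℝ (Submodule.span ℝ {e})ᗮ)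
    rw [InnerProductSpace.euclideanHausdorffMeasure_eq_volume, h0, mul_zero] at hl
    exact le_antisymm hl zero_le
  have hN₂ : volume (mintyInv F e '' N₂) = 0 :=
    addHaar_image_eq_zero_of_det_fderivWithin_eq_zero volume
      (fun y hy => hy.2.1.hasFDerivWithinAt.mono fun y hy => hy.1) fun y hy => hy.2.2
  refine measure_mono_null ?_ (measure_union_null hN₁ hN₂)
  rintro _ ⟨x, ⟨u, hu, huniq, hball⟩, rfl⟩
  have hyY : minty e (x, u) ∈ Y := mem_image_of_mem _ hu
  rw [← image_union]
  refine ⟨minty e (x, u), ?_, mintyInv_minty he hu⟩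
  by_contra hcon
  have hdiff : DifferentiableWithinAt ℝ (mintyInv F e) Y (minty e (x, u)) := by
    by_contra h
    exact hcon (Or.inl ⟨hyY, h⟩)
  have hdet : (fderivWithin ℝ (mintyInv F e) Y (minty e (x, u))).det ≠ 0 := fun h =>
    hcon (Or.inr ⟨hyY, hdiff, h⟩)
  obtain ⟨C, hC, hev⟩ := hdiff.hasFDerivWithinAt.exists_norm_sub_le_of_det_ne_zero hdet
  exact hball (hasInnerBall_of_minty hF hconv he hu huniq hC hev)

variable {K : Set (E d)}

/-! ### Support functions -/

theorem inner_le_supportFun (hK : IsCompact K) {y : E d} (hy : y ∈ K) (u : E d) :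
    inner ℝ y u ≤ supportFun K u :=
  le_csSup (hK.image (f := fun y => inner ℝ y u) (by fun_prop)).bddAbove (mem_image_of_mem _ hy)

theorem exists_inner_eq_supportFun (hK : IsCompact K) (hne : K.Nonempty) (u : E d) :
    ∃ y ∈ K, inner ℝ y u = supportFun K u :=
  (hK.image (f := fun y => inner ℝ y u) (by fun_prop)).sSup_mem (hne.image _)

theorem continuous_supportFun (hK : IsCompact K) : Continuous (supportFun K) :=
  hK.continuous_sSup (f := fun u y => inner ℝ y u) (by fun_prop)

theorem abs_supportFun_le (hK : IsCompact K) (hne : K.Nonempty) {R : ℝ} (hR : ∀ k ∈ K, ‖k‖ ≤ R)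
    (hu : ‖u‖ = 1) : |supportFun K u| ≤ R := by
  obtain ⟨k, hk, h⟩ := exists_inner_eq_supportFun hK hne u
  rw [← h]
  have := abs_real_inner_le_norm k u
  rw [hu, mul_one] at this
  exact this.trans (hR k hk)

/-! ### Parallel displacement of boundary points -/

theorem mem_add_smul_iff {ε : ℝ} : z ∈ F + ε • K ↔ ∃ k ∈ K, z - ε • k ∈ F := by
  constructor
  · rintro ⟨f, hf, _, ⟨k, hk, rfl⟩, rfl⟩
    exact ⟨k, hk, by simpa using hf⟩
  · rintro ⟨k, hk, h⟩
    exact ⟨_, h, _, smul_mem_smul_set hk, by simp⟩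

theorem IsNormal.le_supportFun (h : IsNormal F x u) (hK : IsCompact K) {ε t : ℝ} (hε : 0 < ε)
    (hm : x + (ε * t) • u ∈ F + ε • K) : t ≤ supportFun K u := by
  obtain ⟨k, hk, hf⟩ := mem_add_smul_iff.1 hm
  have h1 := h.2.2 _ hf
  have e1 : x + (ε * t) • u - ε • k - x = (ε * t) • u - ε • k := by abel
  rw [e1, inner_sub_left, inner_smul_left, inner_smul_left, real_inner_self_eq_norm_sq, h.2.1] at h1
  simp only [conj_trivial, one_pow, mul_one] at h1
  have h2 : t ≤ inner ℝ k u := le_of_mul_le_mul_left (by linarith) hε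
  exact h2.trans (inner_le_supportFun hK hk u)

/-- After division by ε, the ball condition for εv tends to 2r⟨v, u⟩ < 0. -/
theorem HasInnerBall.eventually_add_smul_mem (hu : ‖u‖ = 1) (h : HasInnerBall F x u) {v : E d}
    (hv : inner ℝ v u < 0) : ∀ᶠ ε : ℝ in 𝓝[>] 0, x + ε • v ∈ F := by
  obtain ⟨r, hr, hb⟩ := h
  have hlim : Tendsto (fun ε : ℝ => ε * ‖v‖ ^ 2 + 2 * r * inner ℝ v u) (𝓝[>] 0)
      (𝓝 (0 * ‖v‖ ^ 2 + 2 * r * inner ℝ v u)) :=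
    (Continuous.tendsto (by fun_prop) 0).mono_left nhdsWithin_le_nhds
  have hneg : 0 * ‖v‖ ^ 2 + 2 * r * inner ℝ v u < 0 := by
    have : 0 < r * -inner ℝ v u := mul_pos hr (neg_pos.2 hv)
    linarith
  filter_upwards [hlim.eventually_lt_const hneg, eventually_mem_nhdsWithin] with ε h1 (h2 : 0 < ε)
  refine hb ((mem_closedBall_sub_smul hu hr.le).2 ?_)
  rw [norm_smul, inner_smul_left, Real.norm_of_nonneg h2.le, conj_trivial]
  nlinarith [mul_pos h2 (neg_pos.2 h1)]

theorem IsNormal.eventually_mem_iff (h : IsNormal F x u) (hb : HasInnerBall F x u)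
    (hK : IsCompact K) (hne : K.Nonempty) {t : ℝ} (ht : t ≠ supportFun K u) :
    ∀ᶠ ε : ℝ in 𝓝[>] 0, x + (ε * t) • u ∈ F + ε • K ↔ t ≤ supportFun K u := by
  by_cases hlt : t ≤ supportFun K u
  · obtain ⟨k, hk, hku⟩ := exists_inner_eq_supportFun hK hne u
    have hv : inner ℝ (t • u - k) u < 0 := by
      rw [inner_sub_left, inner_smul_left, real_inner_self_eq_norm_sq, h.2.1, hku]
      simp only [conj_trivial, one_pow, mul_one]
      exact sub_neg.2 (lt_of_le_of_ne hlt ht)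
    filter_upwards [hb.eventually_add_smul_mem h.2.1 hv] with ε hε
    refine iff_of_true (mem_add_smul_iff.2 ⟨k, hk, ?_⟩) hlt
    rwa [smul_sub, smul_smul, ← add_sub_assoc] at hε
  · filter_upwards [eventually_mem_nhdsWithin] with ε hε
    exact iff_of_false (fun hm => hlt (h.le_supportFun hK hε hm)) hlt

theorem infDist_le_of_mem_add_smul {R : ℝ} (hR : ∀ k ∈ K, ‖k‖ ≤ R) {ε : ℝ} (hε : 0 ≤ ε)
    (hz : z ∈ F + ε • K) : Metric.infDist z F ≤ ε * R := by
  obtain ⟨k, hk, h⟩ := mem_add_smul_iff.1 hz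
  refine (Metric.infDist_le_dist_of_mem h).trans ?_
  rw [dist_eq_norm, sub_sub_cancel, norm_smul, Real.norm_of_nonneg hε]
  exact mul_le_mul_of_nonneg_left (hR k hk) hε

theorem infDist_coClosure_le_of_notMem_add_smul (hne : K.Nonempty) {R : ℝ} (hR : ∀ k ∈ K, ‖k‖ ≤ R)
    {ε : ℝ} (hε : 0 ≤ ε) (hz : z ∉ F + ε • K) : Metric.infDist z (coClosure F) ≤ ε * R := by
  obtain ⟨k, hk⟩ := hne
  have h : z - ε • k ∈ coClosure F :=
    subset_closure fun hm => hz (mem_add_smul_iff.2 ⟨k, hk, hm⟩)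
  refine (Metric.infDist_le_dist_of_mem h).trans ?_
  rw [dist_eq_norm, sub_sub_cancel, norm_smul, Real.norm_of_nonneg hε]
  exact mul_le_mul_of_nonneg_left (hR k hk) hε

theorem essentiallyBounded_add_smul (hF : IsClosed F) (hconv : Convex ℝ F) (hFne : F.Nonempty)
    (hne' : (coClosure F).Nonempty) (hne : K.Nonempty) {R : ℝ} (hR : ∀ k ∈ K, ‖k‖ ≤ R) :
    EssentiallyBounded F fun ε => (F + ε • K) ∆ F := by
  have hR0 : 0 ≤ R := by
    obtain ⟨k, hk⟩ := hne
    exact (norm_nonneg k).trans (hR k hk)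
  -- The excess set is empty for every ε > 0; R + 1 keeps T positive even if R = 0.
  refine ⟨R + 1, by linarith, tendsto_const_nhds.congr' ?_⟩
  filter_upwards [eventually_mem_nhdsWithin] with ε (hε : 0 < ε)
  have hle : ε * R ≤ ε * (R + 1) := by nlinarith
  have hempty : (F + ε • K) ∆ F ∩ (Metric.cthickening (ε * (R + 1)) (frontier F))ᶜ = ∅ := by
    rw [← sdiff_eq, sdiff_eq_empty]
    rintro z (⟨h1, h2⟩ | ⟨h1, h2⟩)
    · refine Metric.mem_cthickening_of_dist_le z _ _ _
        (isNormal_proj hF hconv hFne h2).mem_frontier ?_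
      rw [(isNearest_proj hF hFne z).2]
      exact (infDist_le_of_mem_add_smul hR hε.le h1).trans hle
    · by_cases hz : z ∈ coClosure F
      · refine Metric.self_subset_cthickening _ ?_
        rw [frontier_eq_closure_inter_closure]
        exact ⟨subset_closure h1, hz⟩
      · refine Metric.mem_cthickening_of_dist_le z _ _ _
          (isNormal_proj_coClosure hF hconv hne' hz).1.mem_frontier ?_
        rw [(isNearest_proj (F := coClosure F) isClosed_closure hne' z).2]
        exact (infDist_coClosure_le_of_notMem_add_smul hne hR hε.le h2).trans hle
  rw [hempty, measure_empty, mul_zero]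

/-! ### The local magnification map -/

theorem tau_outer (h : IsNormal F x u) {ε t : ℝ} (hε : 0 < ε) (ht : 0 < t) :
    tau F ε (x + (ε * t) • u) = (t, x, u) := by
  have hp := mul_pos hε ht
  obtain ⟨h1, h2, h3, -⟩ := h.outer hp
  rw [tau, if_pos (h.notMem hp), h1, h2, h3, mul_div_cancel_left₀ _ hε.ne']

theorem tau_inner (h : IsNormal F x u) {ε t s : ℝ} (hε : 0 < ε) (ht : t < 0) (hts : ε * -t < s)
    (hb : Metric.closedBall (x - s • u) s ⊆ F) :
    tau F ε (x + (ε * t) • u) = (t, x, u) := by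
  have hp := mul_pos hε (neg_pos.2 ht)
  have e1 : x + (ε * t) • u = x - (ε * -t) • u := by rw [mul_neg, neg_smul, sub_neg_eq_add]
  obtain ⟨h1, h2, h3, -⟩ := inner_of_closedBall h.2.1 hp hts hb h.mem_closure_compl
  have hm := interior_subset (sub_smul_mem_interior h.2.1 hp hts hb)
  rw [tau, e1, if_neg (not_not.2 hm), h1, h2, h3, mul_div_cancel_left₀ _ hε.ne', neg_neg, neg_neg]

/-- τ_ε inverts (t, x, u) ↦ x + εtu. The distance clause later bounds t from below. -/
theorem tau_spec (hF : IsClosed F) (hconv : Convex ℝ F) (hne : F.Nonempty)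
    (hne' : (coClosure F).Nonempty) {ε t : ℝ} (hε : 0 < ε) (hz : z ∉ frontier F)
    (h : tau F ε z = (t, x, u)) :
    IsNormal F x u ∧ z = x + (ε * t) • u ∧
      (z ∉ F ∧ 0 < t ∨ z ∈ F ∧ t < 0 ∧ Metric.infDist z (coClosure F) = ε * -t) := by
  by_cases hzF : z ∈ F
  · have hzc : z ∉ coClosure F := fun hc => hz (by
      rw [frontier_eq_closure_inter_closure]
      exact ⟨subset_closure hzF, hc⟩)
    have hpos := infDist_pos_of_notMem isClosed_closure hne' hzc
    rw [tau, if_neg (not_not.2 hzF)] at h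
    obtain ⟨rfl, h2⟩ := Prod.ext_iff.1 h
    obtain ⟨rfl, rfl⟩ := Prod.ext_iff.1 h2
    refine ⟨(isNormal_proj_coClosure hF hconv hne' hzc).1, ?_, Or.inr ⟨hzF, ?_, ?_⟩⟩
    · dsimp only
      rw [mul_neg, mul_div_cancel₀ _ hε.ne', neg_smul, smul_neg, neg_neg]
      exact (proj_add_smul_dir hpos).symm
    · exact neg_neg_of_pos (div_pos hpos hε)
    · dsimp only
      rw [neg_neg, mul_div_cancel₀ _ hε.ne']
  · have hpos := infDist_pos_of_notMem hF hne hzF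
    rw [tau, if_pos hzF] at h
    obtain ⟨rfl, h2⟩ := Prod.ext_iff.1 h
    obtain ⟨rfl, rfl⟩ := Prod.ext_iff.1 h2
    refine ⟨isNormal_proj hF hconv hne hzF, ?_, Or.inl ⟨hzF, div_pos hpos hε⟩⟩
    dsimp only
    rw [mul_div_cancel₀ _ hε.ne']
    exact (proj_add_smul_dir hpos).symm

/-! ### Comparison of the magnified difference with `hSub` -/

/-- The pairs `(x, u)` such that the ball with centre `x - r u` and radius `r` lies in `F`. -/
def ballSet (F : Set (E d)) (r : ℝ) : Set (E d × E d) :=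
  {q | ∀ v : E d, ‖v‖ ≤ 1 → q.1 - r • q.2 + r • v ∈ F}

/-- For fixed v the condition is a closed preimage; hence the definition by unit-ball vectors. -/
theorem isClosed_ballSet (hF : IsClosed F) (r : ℝ) : IsClosed (ballSet F r) := by
  have : ballSet F r = ⋂ (v : E d) (_ : ‖v‖ ≤ 1),
      (fun q : E d × E d => q.1 - r • q.2 + r • v) ⁻¹' F := by
    ext q; simp [ballSet]
  rw [this]
  exact isClosed_iInter fun v => isClosed_iInter fun _ => hF.preimage (by fun_prop)

theorem mem_ballSet {r : ℝ} (hr : 0 < r) :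
    (x, u) ∈ ballSet F r ↔ Metric.closedBall (x - r • u) r ⊆ F := by
  constructor
  · intro h y hy
    rw [Metric.mem_closedBall, dist_eq_norm] at hy
    have := h (r⁻¹ • (y - (x - r • u))) (by
      rw [norm_smul, norm_inv, Real.norm_of_nonneg hr.le, inv_mul_le_iff₀ hr, mul_one]
      exact hy)
    rwa [smul_smul, mul_inv_cancel₀ hr.ne', one_smul, add_sub_cancel] at this
  · intro h v hv
    refine h ?_
    rw [Metric.mem_closedBall, dist_eq_norm, add_sub_cancel_left, norm_smul,
      Real.norm_of_nonneg hr.le]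
    exact mul_le_of_le_one_right hr.le hv

theorem HasInnerBall.eventually_mem_ballSet (hu : ‖u‖ = 1) (h : HasInnerBall F x u) {c : ℝ}
    (hc : 0 < c) : ∀ᶠ ε : ℝ in 𝓝[>] 0, (x, u) ∈ ballSet F (ε * c) := by
  obtain ⟨r, hr, hb⟩ := h
  have h1 : ∀ᶠ ε : ℝ in 𝓝[>] 0, ε < r / c :=
    (eventually_lt_nhds (by positivity)).filter_mono nhdsWithin_le_nhds
  filter_upwards [h1, eventually_mem_nhdsWithin] with ε h2 (h3 : 0 < ε)
  have h4 : ε * c < r := (lt_div_iff₀ hc).1 h2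
  exact (mem_ballSet (by positivity)).2
    ((closedBall_sub_smul_mono hu (by positivity) h4.le).trans hb)

theorem measurableSet_hasInnerBall (hF : IsClosed F) :
    MeasurableSet {q : E d × E d | IsNormal F q.1 q.2 ∧ HasInnerBall F q.1 q.2} := by
  have : {q : E d × E d | IsNormal F q.1 q.2 ∧ HasInnerBall F q.1 q.2} =
      {q | IsNormal F q.1 q.2} ∩ ⋃ n : ℕ, ballSet F (1 / ((n : ℝ) + 1)) := by
    ext ⟨x, u⟩
    refine and_congr_right fun (hn : IsNormal F x u) => ⟨?_, fun h => ?_⟩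
    · rintro ⟨r, hr, hb⟩
      obtain ⟨n, hn'⟩ := exists_nat_one_div_lt hr
      have hp : (0 : ℝ) < 1 / ((n : ℝ) + 1) := by positivity
      exact mem_iUnion.2 ⟨n, (mem_ballSet hp).2
        ((closedBall_sub_smul_mono hn.2.1 hp.le hn'.le).trans hb)⟩
    · obtain ⟨n, hn'⟩ := mem_iUnion.1 h
      have hp : (0 : ℝ) < 1 / ((n : ℝ) + 1) := by positivity
      exact ⟨_, hp, (mem_ballSet hp).1 hn'⟩
  rw [this]
  exact (isClosed_setOf_isNormal hF).measurableSet.inter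
    (MeasurableSet.iUnion fun n => (isClosed_ballSet hF _).measurableSet)

/-- A measurable set that contains the difference of the magnified set and `hSub K F`. -/
def errorSet (F K : Set (E d)) (R ε : ℝ) : Set (ℝ × E d × E d) :=
  {q | IsNormal F q.2.1 q.2.2 ∧ |q.1| ≤ R ∧ (q.1 = supportFun K q.2.2 ∨
    q.2 ∉ ballSet F (ε * (R + 1)) ∨
    ¬ (q.2.1 + (ε * q.1) • q.2.2 ∈ F + ε • K ↔ q.1 ≤ supportFun K q.2.2))}

theorem measurableSet_errorSet (hF : IsCompact F) (hK : IsCompact K) (R ε : ℝ) :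
    MeasurableSet (errorSet F K R ε) := by
  have hs : Continuous fun q : ℝ × E d × E d => supportFun K q.2.2 :=
    (continuous_supportFun hK).comp (by fun_prop)
  have hG : IsClosed (F + ε • K) := (hF.add (hK.smul ε)).isClosed
  refine MeasurableSet.inter (s₁ := {q : ℝ × E d × E d | IsNormal F q.2.1 q.2.2})
    ((isClosed_setOf_isNormal hF.isClosed).preimage continuous_snd).measurableSet ?_
  refine MeasurableSet.inter (s₁ := {q : ℝ × E d × E d | |q.1| ≤ R})
    (isClosed_le (by fun_prop) (by fun_prop)).measurableSet ?_
  refine MeasurableSet.union (s₁ := {q : ℝ × E d × E d | q.1 = supportFun K q.2.2})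
    (isClosed_eq continuous_fst hs).measurableSet ?_
  refine MeasurableSet.union (s₁ := {q : ℝ × E d × E d | q.2 ∉ ballSet F (ε * (R + 1))})
    ((isClosed_ballSet hF.isClosed _).preimage continuous_snd).measurableSet.compl ?_
  refine MeasurableSet.compl (Measurable.setOf (Measurable.iff ?_ ?_))
  · refine measurableSet_setOfPred.1 (hG.preimage ?_).measurableSet
    fun_prop
  · exact measurableSet_setOfPred.1 (isClosed_le continuous_fst hs).measurableSet

/-- The inclusion bounds the measure without measurability of the magnified set. Since |h_K(u)| ≤ R,
all relevant t satisfy |t| ≤ R, and an inner ball of radius ε(R+1) strictly exceeds the depth ε|t|.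
-/
theorem symmDiff_subset_errorSet (hF : IsClosed F) (hconv : Convex ℝ F) (hFne : F.Nonempty)
    (hne' : (coClosure F).Nonempty) (hK : IsCompact K) (hne : K.Nonempty) {R : ℝ}
    (hR : ∀ k ∈ K, ‖k‖ ≤ R) {ε : ℝ} (hε : 0 < ε) :
    tauImage F ε ((F + ε • K) ∆ F) ∆ hSub K F ⊆ errorSet F K R ε := by
  have hNor := NorE_eq hF hconv hFne hne'
  have hcyl : ∀ q : ℝ × E d × E d, q ∈ cylinder F ↔ IsNormal F q.2.1 q.2.2 := fun q => by
    rw [cylinder, hNor]; simp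
  rintro ⟨t, x, u⟩ (⟨⟨z, ⟨hzA, hz⟩, hτ⟩, hq⟩ | ⟨hq, hτ⟩)
  · obtain ⟨hn, hzx, hcase⟩ :=
      tau_spec hF hconv hFne hne' hε (fun h => hz (Or.inr h)) hτ
    have hzE : x + (ε * t) • u ∈ F + ε • K ↔ z ∈ F + ε • K := by rw [hzx]
    have hR' := abs_le.1 (abs_supportFun_le hK hne hR hn.2.1)
    rcases hcase with ⟨hzF, ht⟩ | ⟨hzF, ht, hdist⟩
    · have hzG : z ∈ F + ε • K := hzA.elim (fun h => h.1) fun h => absurd h.1 hzF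
      have hle := hn.le_supportFun hK hε (hzE.2 hzG)
      exact absurd (Or.inl ⟨(hcyl _).2 hn, ht, hle⟩) hq
    · have hzG : z ∉ F + ε • K := hzA.elim (fun h => absurd hzF h.2) fun h => h.2
      have hd := infDist_coClosure_le_of_notMem_add_smul hne hR hε.le hzG
      rw [hdist] at hd
      have hle : -t ≤ R := le_of_mul_le_mul_left hd hε
      refine ⟨hn, abs_le.2 ⟨by linarith, by dsimp only; linarith⟩, ?_⟩
      by_contra! hcon
      have h1 : ¬ t ≤ supportFun K u := fun h => hzG (hzE.1 (hcon.2.2.2 h))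
      exact hq (Or.inr ⟨(hcyl _).2 hn, (not_le.1 h1).le, ht⟩)
  · have hn : IsNormal F x u := by
      rcases hq with h | h <;> exact (hcyl _).1 h.1
    have hR' := abs_le.1 (abs_supportFun_le hK hne hR hn.2.1)
    have hR0 : 0 ≤ R := (abs_nonneg _).trans (abs_le.2 hR')
    by_contra hcon
    have hcon' : |t| ≤ R → t ≠ supportFun K u ∧ (x, u) ∈ ballSet F (ε * (R + 1)) ∧
        (x + (ε * t) • u ∈ F + ε • K ↔ t ≤ supportFun K u) := by
      intro h
      refine ⟨fun h' => hcon ⟨hn, h, Or.inl h'⟩, ?_, ?_⟩ <;> by_contra h'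
      · exact hcon ⟨hn, h, Or.inr (Or.inl h')⟩
      · exact hcon ⟨hn, h, Or.inr (Or.inr h')⟩
    rcases hq with ⟨-, ht, hle⟩ | ⟨-, hle, ht⟩
    · dsimp only at ht hle
      obtain ⟨-, -, hiff⟩ := hcon' (abs_le.2 ⟨by linarith, by linarith⟩)
      have hp := mul_pos hε ht
      have hzF := hn.notMem hp
      refine hτ ⟨_, ⟨Or.inl ⟨hiff.2 hle, hzF⟩, ?_⟩, tau_outer hn hε ht⟩
      rintro (h | h)
      · exact hn.outer_notMem_skeleton_frontier hF hp h
      · exact hzF (hF.frontier_subset h)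
    · dsimp only at ht hle
      obtain ⟨hne'', hball, hiff⟩ := hcon' (abs_le.2 ⟨by linarith, by linarith⟩)
      have hlt : ¬ t ≤ supportFun K u := fun h => hne'' (le_antisymm h hle)
      rw [mem_ballSet (by positivity)] at hball
      have hp := mul_pos hε (neg_pos.2 ht)
      have hts : ε * -t < ε * (R + 1) := mul_lt_mul_of_pos_left (by linarith) hε
      have e1 : x + (ε * t) • u = x - (ε * -t) • u := by rw [mul_neg, neg_smul, sub_neg_eq_add]
      have hint := sub_smul_mem_interior hn.2.1 hp hts hball
      rw [← e1] at hint
      refine hτ ⟨_, ⟨Or.inr ⟨interior_subset hint, fun h => hlt (hiff.1 h)⟩, ?_⟩,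
        tau_inner hn hε ht hts hball⟩
      rintro (h | h)
      · rw [e1] at h
        exact inner_notMem_skeleton_frontier hn.2.1 hp hts hball hn.mem_frontier h
      · exact h.2 hint

/-! ### The support measure -/

theorem aemeasurable_nu (hF : IsCompact F) (hNor : NorE F = {q | IsNormal F q.1 q.2})
    (μ : Measure (E d)) :
    AEMeasurable (fun x => (x, nu F x)) (μ.restrict {x | ∃! u, IsNormal F x u}) :=
  (continuousOn_id.prodMk (continuousOn_nu hF.isClosed hNor)).aemeasurable
    (measurableSet_setOf_existsUnique_isNormal hF)

theorem isFiniteMeasure_Theta (hd : 1 ≤ d) (hF : IsCompact F)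
    (hreg : regE F = {x | ∃! u, IsNormal F x u}) : IsFiniteMeasure (Theta F) := by
  have h : (Measure.euclideanHausdorffMeasure (d - 1) : Measure (E d)) (regE F) < ⊤ := by
    refine (measure_mono ?_).trans_lt (euclideanHausdorffMeasure_setOf_isNormal_lt_top hd hF)
    rw [hreg]
    exact fun x hx => hx.exists
  have := isFiniteMeasure_restrict.2 h.ne
  exact Measure.isFiniteMeasure_map _ _

theorem ae_Theta_hasInnerBall (hd : 1 ≤ d) (hF : IsCompact F) (hconv : Convex ℝ F)
    (hNor : NorE F = {q | IsNormal F q.1 q.2}) (hreg : regE F = {x | ∃! u, IsNormal F x u}) :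
    ∀ᵐ q ∂Theta F, IsNormal F q.1 q.2 ∧ HasInnerBall F q.1 q.2 := by
  rw [Theta, hreg, ae_map_iff (aemeasurable_nu hF hNor _) (measurableSet_hasInnerBall hF.isClosed),
    ae_restrict_iff' (measurableSet_setOf_existsUnique_isNormal hF)]
  have h := euclideanHausdorffMeasure_not_hasInnerBall hd hF.isClosed hconv
  filter_upwards [measure_eq_zero_iff_ae_notMem.1 h] with x hx hxu
  have hn := isNormal_nu hNor hxu.exists
  refine ⟨hn, ?_⟩
  by_contra hcon
  exact hx ⟨_, hn, fun v hv => hxu.unique hv hn, hcon⟩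

theorem ae_M_eventually_notMem_errorSet (hd : 1 ≤ d) (hF : IsCompact F) (hconv : Convex ℝ F)
    (hNor : NorE F = {q | IsNormal F q.1 q.2}) (hreg : regE F = {x | ∃! u, IsNormal F x u})
    (hK : IsCompact K) (hne : K.Nonempty) {R : ℝ} (hR : 0 ≤ R) :
    ∀ᵐ q ∂M F, ∀ᶠ ε : ℝ in 𝓝[>] 0, q ∉ errorSet F K R ε := by
  have := isFiniteMeasure_Theta hd hF hreg
  have h1 : ∀ᵐ q ∂M F, IsNormal F q.2.1 q.2.2 ∧ HasInnerBall F q.2.1 q.2.2 :=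
    Measure.quasiMeasurePreserving_snd.ae (ae_Theta_hasInnerBall hd hF hconv hNor hreg)
  have hs : Continuous fun q : ℝ × E d × E d => supportFun K q.2.2 :=
    (continuous_supportFun hK).comp (by fun_prop)
  -- For fixed (x, u) only one t is excluded, so Fubini gives a null set.
  have h2 : ∀ᵐ q ∂M F, q.1 ≠ supportFun K q.2.2 := by
    rw [ae_iff, M, Measure.prod_apply_symm]
    · simp
    · simpa using (isClosed_eq continuous_fst hs).measurableSet
  filter_upwards [h1, h2] with q hq1 hq2
  filter_upwards [hq1.2.eventually_mem_ballSet hq1.1.2.1 (by linarith : 0 < R + 1),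
    hq1.1.eventually_mem_iff hq1.2 hK hne hq2] with ε h3 h4
  rintro ⟨-, -, h | h | h⟩
  exacts [hq2 h, h h3, h h4]

theorem measurableSet_hSub (hF : IsClosed F) (hNor : NorE F = {q | IsNormal F q.1 q.2})
    (hK : IsCompact K) : MeasurableSet (hSub K F) := by
  have hs : Continuous fun q : ℝ × E d × E d => supportFun K q.2.2 :=
    (continuous_supportFun hK).comp (by fun_prop)
  have hc : MeasurableSet (cylinder F) := by
    rw [cylinder, hNor]
    exact MeasurableSet.univ.prod (isClosed_setOf_isNormal hF).measurableSet
  have h1 : MeasurableSet {q : ℝ × E d × E d | 0 < q.1} :=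
    (isOpen_lt continuous_const continuous_fst).measurableSet
  have h2 : MeasurableSet {q : ℝ × E d × E d | q.1 ≤ supportFun K q.2.2} :=
    (isClosed_le continuous_fst hs).measurableSet
  have h3 : MeasurableSet {q : ℝ × E d × E d | supportFun K q.2.2 ≤ q.1} :=
    (isClosed_le hs continuous_fst).measurableSet
  have h4 : MeasurableSet {q : ℝ × E d × E d | q.1 < 0} :=
    (isOpen_lt continuous_fst continuous_const).measurableSet
  exact (hc.inter (h1.inter h2)).union (hc.inter (h3.inter h4))

theorem hasSetDeriv_add_smul (hd : 1 ≤ d) (hF : IsCompact F) (hconv : Convex ℝ F)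
    (hint : (interior F).Nonempty) (hK : IsCompact K) (hne : K.Nonempty) :
    HasSetDeriv F (fun ε => F + ε • K) (hSub K F) := by
  have hFne : F.Nonempty := hint.mono interior_subset
  have hne' : (coClosure F).Nonempty := by
    -- For d ≥ 1 the space is not compact, so F has a nonempty complement.
    have : Nonempty (Fin d) := ⟨⟨0, hd⟩⟩
    exact (nonempty_compl.2 hF.ne_univ).mono subset_closure
  have hNor := NorE_eq hF.isClosed hconv hFne hne'
  have hreg := regE_eq hF.isClosed hconv hint hne'
  have h0 : F + (0 : ℝ) • K = F := by rw [zero_smul_set hne, add_zero]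
  obtain ⟨R, hR⟩ := hK.isBounded.exists_norm_le
  have hR0 : 0 ≤ R := by
    obtain ⟨k, hk⟩ := hne
    exact (norm_nonneg k).trans (hR k hk)
  refine ⟨h0, ?_, ?_, ?_, ?_, ?_, ?_⟩
  · exact fun ε _ => (hF.add (hK.smul ε)).measurableSet.symmDiff hF.measurableSet
  · simp only [h0, symmDiff_self]
    exact empty_subset _
  · exact essentiallyBounded_add_smul hF.isClosed hconv hFne hne' hne hR
  · exact measurableSet_hSub hF.isClosed hNor hK
  · rintro q (h | h) <;> exact h.1
  · have := isFiniteMeasure_Theta hd hF hreg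
    -- Dominated convergence: [−R, R] times the whole space contains every error set and has finite
    -- measure.
    have hlim : Tendsto (fun ε => M F (errorSet F K R ε)) (𝓝[>] 0) (𝓝 (M F ∅)) := by
      refine tendsto_measure_of_ae_tendsto_indicator (B := Icc (-R) R ×ˢ univ) _
        MeasurableSet.empty (measurableSet_errorSet hF hK R)
        (measurableSet_Icc.prod MeasurableSet.univ) ?_ ?_ ?_
      · rw [M, Measure.prod_prod]
        exact (ENNReal.mul_lt_top (by simp) (measure_lt_top _ _)).ne
      · exact Eventually.of_forall fun ε q hq => ⟨abs_le.1 hq.2.1, mem_univ _⟩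
      · filter_upwards [ae_M_eventually_notMem_errorSet hd hF hconv hNor hreg hK hne hR0] with q hq
        exact hq.mono fun ε hε => iff_of_false hε (notMem_empty _)
    rw [measure_empty] at hlim
    refine tendsto_of_tendsto_of_tendsto_of_le_of_le' tendsto_const_nhds hlim
      (Eventually.of_forall fun _ => zero_le) ?_
    filter_upwards [eventually_mem_nhdsWithin] with ε hε
    exact measure_mono (symmDiff_subset_errorSet hF.isClosed hconv hFne hne' hK hne hR hε)

end SetDerivative

theorem corollary13 (d : ℕ) (hd : 1 ≤ d)
    (F K : ConvexBody (EuclideanSpace ℝ (Fin d)))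
    (hF : (interior (F : Set (EuclideanSpace ℝ (Fin d)))).Nonempty) :
    SetDerivative.SetDifferentiable (F : Set (EuclideanSpace ℝ (Fin d)))
        (fun ε : ℝ => (F : Set (EuclideanSpace ℝ (Fin d))) + ε • (K : Set (EuclideanSpace ℝ (Fin d)))) ∧
      SetDerivative.HasSetDeriv (F : Set (EuclideanSpace ℝ (Fin d)))
        (fun ε : ℝ => (F : Set (EuclideanSpace ℝ (Fin d))) + ε • (K : Set (EuclideanSpace ℝ (Fin d))))
        (SetDerivative.hSub (K : Set (EuclideanSpace ℝ (Fin d)))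
          (F : Set (EuclideanSpace ℝ (Fin d)))) := by
  have h := SetDerivative.hasSetDeriv_add_smul hd F.isCompact F.convex hF K.isCompact K.nonempty
  exact ⟨⟨_, h⟩, h⟩
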